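/- Let $(M^{2n},g,J)$ be a connected strict nearly Kähler manifold: $g=\langle\cdot,\cdot\rangle$ is a smooth Riemannian metric on the smooth connected manifold $M$, $J$ is a smooth orthogonal almost complex structure, and, with $\nabla$ the Levi-Civita connection of $g$, $(\nabla_XJ)X=0$ for every tangent vector $X$, and $\nabla_XJ\neq 0$ for every tangent vector $X\neq 0$. Let $R$ be the curvature tensor of $g$, with the sign for which $R(X,Y,X,Y)$ is the sectional curvature of an orthonormal pair $X,Y$. For a local orthonormal frame $(e_k)$ put $$Ric(X,Y)=\sum_k R(X,e_k,Y,e_k),\qquad Ric^{\star}(X,Y)=\tfrac12\sum_k R(X,JY,e_k,Je_k),$$ and let $r:TM\to TM$ be the tensor defined by $\langle rX,Y\rangle=\sum_k\langle(\nabla_{e_k}J)X,(\nabla_{e_k}J)Y\rangle$. Then $\langle rX,Y\rangle=Ric(X,Y)-Ric^{\star}(X,Y)$ for all $X,Y$, and there are pairwise distinct real numbers $\lambda_1,\dots,\lambda_p>0$ that are the eigenvalues of $r$ at every point of $M$, so that $TM=\bigoplus_{i=1}^pE_i$, where $E_i$ is the eigenbundle of $r$ for the eigenvalue $\lambda_i$.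 With respect to this decomposition: (i) $Ric(X,Y)=0$ if $X$ belongs to $E_i$, $Y$ belongs to $E_j$ and $i\neq j$. (ii) If $X,Y$ belong to $E_i$, then $$Ric(X,Y)=\frac{\lambda_i}{4}\langle X,Y\rangle+\frac1{\lambda_i}\sum_{s=1}^p\lambda_s\langle r^s(X),Y\rangle,$$ where the tensors $r^s:TM\to TM$, $1\le s\le p$, are defined by $\langle r^s(X),Y\rangle=-\mathrm{Tr}_{E_s}\big((\nabla_XJ)(\nabla_YJ)\big)$ for all $X,Y$ in $TM$, and $\mathrm{Tr}_{W}(A)=\sum_k\langle Aw_k,w_k\rangle$ for an orthonormal basis $(w_k)$ of $W$. -/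

import Mathlib

open Bundle Manifold FiberBundle VectorField
open scoped ContDiff

namespace NearlyKahler

noncomputable section

section LinearAlgebra

variable {V : Type*} [NormedAddCommGroup V] [InnerProductSpace ℝ V] [FiniteDimensional ℝ V]

/-- The endomorphism `S` with `⟪S u, w⟫ = B u w`. -/
def ofForm (B : V →L[ℝ] V →L[ℝ] ℝ) : V →L[ℝ] V :=
  LinearMap.toContinuousLinearMap
    { toFun := fun u => (InnerProductSpace.toDual ℝ V).symm (B u)
      map_add' := by simp
      map_smul' := by simp }

theorem inner_ofForm (B : V →L[ℝ] V →L[ℝ] ℝ) (u w : V) :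
    inner ℝ (ofForm B u) w = B u w := by
  simp [ofForm]

/-- The trace of the endomorphism `A` over the subspace `W`, i.e. `∑ₖ ⟪A eₖ, eₖ⟫` where `(eₖ)` is
an orthonormal basis of `W`. -/
def traceOn (W : Submodule ℝ V) (A : V →L[ℝ] V) : ℝ :=
  ∑ k, inner ℝ (A (stdOrthonormalBasis ℝ W k)) (stdOrthonormalBasis ℝ W k : V)

end LinearAlgebra

variable {E : Type*} [NormedAddCommGroup E] [NormedSpace ℝ E]
  {H : Type*} [TopologicalSpace H] (I : ModelWithCorners ℝ E H)
  {M : Type*} [TopologicalSpace M] [ChartedSpace H M]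

instance [FiniteDimensional ℝ E] (x : M) : FiniteDimensional ℝ (TangentSpace I x) :=
  inferInstanceAs (FiniteDimensional ℝ E)

section LeviCivita

variable [RiemannianBundle (fun x : M => TangentSpace I x)]

/-- Half of the right-hand side of the Koszul formula for `⟪∇_X Y, Z⟫`. -/
def koszul (X Y Z : Π x : M, TangentSpace I x) (x : M) : ℝ :=
  (1 / 2 : ℝ) *
    (d% (fun y => inner ℝ (Y y) (Z y)) x (X x)
      + d% (fun y => inner ℝ (Z y) (X y)) x (Y x)
      - d% (fun y => inner ℝ (X y) (Y y)) x (Z x)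
      + inner ℝ (mlieBracket I X Y x) (Z x)
      - inner ℝ (mlieBracket I Y Z x) (X x)
      + inner ℝ (mlieBracket I Z X x) (Y x))

variable [FiniteDimensional ℝ E] [IsManifold I ∞ M]
  [IsContMDiffRiemannianBundle I ∞ E (fun x : M => TangentSpace I x)]

set_option linter.unusedSectionVars false in
theorem mdifferentiableAt_inner {X Y : Π x : M, TangentSpace I x} {x : M}
    (hX : MDiffAt (T% X) x) (hY : MDiffAt (T% Y) x) :
    MDiffAt (fun y => inner ℝ (X y) (Y y)) x :=
  MDifferentiableAt.inner_bundle (IB := I) (F := E) (E := fun y : M => TangentSpace I y)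
    (b := fun y => y) hX hY

theorem koszul_tensorial_left {Y Z : Π x : M, TangentSpace I x} {x : M}
    (hY : MDiffAt (T% Y) x) (hZ : MDiffAt (T% Z) x) :
    TensorialAt I E (fun X => koszul I X Y Z x) x where
  smul {f X} hf hX := by
    have h1 := mvfderiv_fun_mul hf (mdifferentiableAt_inner I hZ hX)
    have h2 := mvfderiv_fun_mul hf (mdifferentiableAt_inner I hX hY)
    simp only [koszul, Pi.smul_apply', inner_smul_left, inner_smul_right, map_smul,
      RCLike.conj_to_real]
    rw [h1, h2, mlieBracket_smul_left hf hX, mlieBracket_smul_right hf hX]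
    simp [inner_add_left, inner_smul_left, real_inner_comm]
    ring
  add {X X'} hX hX' := by
    have h1 := mvfderiv_fun_add (mdifferentiableAt_inner I hZ hX) (mdifferentiableAt_inner I hZ hX')
    have h2 := mvfderiv_fun_add (mdifferentiableAt_inner I hX hY) (mdifferentiableAt_inner I hX' hY)
    simp only [koszul, Pi.add_apply, inner_add_left, inner_add_right, map_add]
    rw [h1, h2, mlieBracket_add_left hX hX', mlieBracket_add_right hX hX']
    simp [inner_add_left]
    ring

theorem koszul_tensorial_right {X Y : Π x : M, TangentSpace I x} {x : M}
    (hX : MDiffAt (T% X) x) (hY : MDiffAt (T% Y) x) :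
    TensorialAt I E (fun Z => koszul I X Y Z x) x where
  smul {f Z} hf hZ := by
    have h1 := mvfderiv_fun_mul hf (mdifferentiableAt_inner I hY hZ)
    have h2 := mvfderiv_fun_mul hf (mdifferentiableAt_inner I hZ hX)
    simp only [koszul, Pi.smul_apply', inner_smul_left, inner_smul_right, map_smul,
      RCLike.conj_to_real]
    rw [h1, h2, mlieBracket_smul_left hf hZ, mlieBracket_smul_right hf hZ]
    simp [inner_add_left, inner_smul_left, real_inner_comm]
    ring
  add {Z Z'} hZ hZ' := by
    have h1 := mvfderiv_fun_add (mdifferentiableAt_inner I hY hZ) (mdifferentiableAt_inner I hY hZ')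
    have h2 := mvfderiv_fun_add (mdifferentiableAt_inner I hZ hX) (mdifferentiableAt_inner I hZ' hX)
    simp only [koszul, Pi.add_apply, inner_add_left, inner_add_right, map_add]
    rw [h1, h2, mlieBracket_add_left hZ hZ', mlieBracket_add_right hZ hZ']
    simp [inner_add_left]
    ring

open Classical in
/-- The Levi-Civita connection on vector fields, through the Koszul formula: `leviCivitaFun I Y x v`
is `∇_v Y`, for `Y` differentiable at `x` (and a junk value otherwise). -/
def leviCivitaFun (Y : Π x : M, TangentSpace I x) (x : M) :
    TangentSpace I x →L[ℝ] TangentSpace I x :=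
  if hY : MDiffAt (T% Y) x then
    ofForm (TensorialAt.mkHom₂ (I := I) (F := E) (F' := E) (fun X Z => koszul I X Y Z x) x
      (fun _ hZ => koszul_tensorial_left I hY hZ)
      (fun _ hX => koszul_tensorial_right I hX hY))
  else 0

theorem inner_leviCivitaFun {X Y Z : Π x : M, TangentSpace I x} {x : M}
    (hX : MDiffAt (T% X) x) (hY : MDiffAt (T% Y) x) (hZ : MDiffAt (T% Z) x) :
    inner ℝ (leviCivitaFun I Y x (X x)) (Z x) = koszul I X Y Z x := by
  rw [leviCivitaFun, dif_pos hY, inner_ofForm]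
  exact TensorialAt.mkHom₂_apply _ _ hX hZ

theorem isCovariantDerivativeOn_leviCivitaFun :
    IsCovariantDerivativeOn E (leviCivitaFun I (M := M)) Set.univ where
  add {Y Y' x} hY hY' _ := by
    ext v
    refine ext_inner_right ℝ fun w => ?_
    have hX := mdifferentiableAt_extend I E v
    have hZ := mdifferentiableAt_extend I E w
    have h1 := mvfderiv_fun_add (mdifferentiableAt_inner I hY hZ) (mdifferentiableAt_inner I hY' hZ)
    have h2 := mvfderiv_fun_add (mdifferentiableAt_inner I hX hY) (mdifferentiableAt_inner I hX hY')
    have e := inner_leviCivitaFun I hX (mdifferentiableAt_add_section hY hY') hZ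
    have e1 := inner_leviCivitaFun I hX hY hZ
    have e2 := inner_leviCivitaFun I hX hY' hZ
    simp only [extend_apply_self] at e e1 e2
    rw [e, add_apply, inner_add_left, e1, e2]
    simp only [koszul, Pi.add_apply, inner_add_left, inner_add_right, map_add]
    rw [h1, h2, mlieBracket_add_left hY hY', mlieBracket_add_right hY hY']
    simp [inner_add_left]
    ring
  leibniz {Y f x} hY hf _ := by
    ext v
    refine ext_inner_right ℝ fun w => ?_
    have hX := mdifferentiableAt_extend I E v
    have hZ := mdifferentiableAt_extend I E w
    have h1 := mvfderiv_fun_mul hf (mdifferentiableAt_inner I hY hZ)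
    have h2 := mvfderiv_fun_mul hf (mdifferentiableAt_inner I hX hY)
    have e := inner_leviCivitaFun I hX (hf.smul_section hY) hZ
    have e1 := inner_leviCivitaFun I hX hY hZ
    simp only [extend_apply_self] at e e1
    rw [e, add_apply, inner_add_left, smul_apply,
      inner_smul_left, e1]
    simp only [koszul, Pi.smul_apply', inner_smul_left, inner_smul_right, map_smul,
      RCLike.conj_to_real]
    rw [h1, h2, mlieBracket_smul_left hf hY, mlieBracket_smul_right hf hY]
    simp [inner_add_left, inner_smul_left, real_inner_comm]
    ring

variable (M) in
/-- The Levi-Civita connection of the Riemannian manifold `M`; `leviCivita I M Y x v` is `∇_v Y`. -/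
def leviCivita : CovariantDerivative I E (fun x : M => TangentSpace I x) where
  toFun := leviCivitaFun I
  isCovariantDerivativeOnUniv := isCovariantDerivativeOn_leviCivitaFun I

theorem inner_leviCivita {X Y Z : Π x : M, TangentSpace I x} {x : M}
    (hX : MDiffAt (T% X) x) (hY : MDiffAt (T% Y) x) (hZ : MDiffAt (T% Z) x) :
    inner ℝ (leviCivita I M Y x (X x)) (Z x) = koszul I X Y Z x :=
  inner_leviCivitaFun I hX hY hZ

theorem leviCivita_torsion : (leviCivita I M).torsion = 0 := by
  rw [CovariantDerivative.torsion_eq_zero_iff]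
  intro X Y x hX hY
  refine ext_inner_right ℝ fun w => ?_
  have hZ := mdifferentiableAt_extend I E w
  have e1 := inner_leviCivita I hX hY hZ
  have e2 := inner_leviCivita I hY hX hZ
  simp only [extend_apply_self] at e1 e2
  rw [inner_sub_left, e1, e2]
  simp only [koszul]
  rw [mlieBracket_swap_apply (V := Y) (W := X), mlieBracket_swap_apply (V := extend E w) (W := Y),
    mlieBracket_swap_apply (V := extend E w) (W := X)]
  simp [real_inner_comm, inner_neg_left]
  ring

theorem leviCivita_metric {X Y Z : Π x : M, TangentSpace I x} {x : M}
    (hX : MDiffAt (T% X) x) (hY : MDiffAt (T% Y) x) (hZ : MDiffAt (T% Z) x) :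
    d% (fun y => inner ℝ (Y y) (Z y)) x (X x) =
      inner ℝ (leviCivita I M Y x (X x)) (Z x) + inner ℝ (Y x) (leviCivita I M Z x (X x)) := by
  rw [real_inner_comm (leviCivita I M Z x (X x)), inner_leviCivita I hX hY hZ,
    inner_leviCivita I hX hZ hY]
  simp only [koszul]
  rw [mlieBracket_swap_apply (V := Z) (W := Y), mlieBracket_swap_apply (V := Y) (W := X),
    mlieBracket_swap_apply (V := Z) (W := X)]
  simp [real_inner_comm, inner_neg_left]
  ring

/-- The vector field `R(X, Y)Z = ∇_X ∇_Y Z - ∇_Y ∇_X Z - ∇_[X,Y] Z`. -/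
def curvatureField (X Y Z : Π x : M, TangentSpace I x) (x : M) : TangentSpace I x :=
  leviCivita I M (fun y => leviCivita I M Z y (Y y)) x (X x)
    - leviCivita I M (fun y => leviCivita I M Z y (X y)) x (Y x)
    - leviCivita I M Z x (mlieBracket I X Y x)

/-- The curvature tensor `R(a, b, c, d) = -⟪R(a, b)c, d⟫`, with the sign for which `R(a, b, a, b)` is
the sectional curvature of an orthonormal pair. As `R` is a tensor, its value on tangent vectors at
`x` is computed on vector fields that extend them and are smooth near `x`. -/
def curvature (x : M) (a b c d : TangentSpace I x) : ℝ :=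
  -inner ℝ (curvatureField I (extend E a) (extend E b) (extend E c) x) d

/-- The Ricci tensor `Ric(u, v) = ∑ₖ R(u, eₖ, v, eₖ)`, for an orthonormal basis `(eₖ)`. -/
def ricci (x : M) (u v : TangentSpace I x) : ℝ :=
  ∑ k, curvature I x u (stdOrthonormalBasis ℝ (TangentSpace I x) k) v
    (stdOrthonormalBasis ℝ (TangentSpace I x) k)

end LeviCivita

/-- An almost Hermitian structure on the Riemannian manifold `M`: a smooth orthogonal almost complex
structure. -/
structure AlmostHermitian (M : Type*) [TopologicalSpace M] [ChartedSpace H M] [IsManifold I ∞ M]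
    [RiemannianBundle (fun x : M => TangentSpace I x)] where
  J : Π x : M, TangentSpace I x →L[ℝ] TangentSpace I x
  contMDiff : ContMDiff I (I.prod 𝓘(ℝ, E →L[ℝ] E)) ∞
    (fun x : M => TotalSpace.mk' (E →L[ℝ] E)
      (E := fun y : M => TangentSpace I y →L[ℝ] TangentSpace I y) x (J x))
  sq : ∀ (x : M) (v : TangentSpace I x), J x (J x v) = -v
  inner_map : ∀ (x : M) (u v : TangentSpace I x), inner ℝ (J x u) (J x v) = inner ℝ u v

namespace AlmostHermitian

variable {I} [FiniteDimensional ℝ E] [IsManifold I ∞ M]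
  [RiemannianBundle (fun x : M => TangentSpace I x)]
  [IsContMDiffRiemannianBundle I ∞ E (fun x : M => TangentSpace I x)]
  (𝒥 : AlmostHermitian I M)

set_option linter.unusedSectionVars false in
theorem mdifferentiableAt_apply {Y : Π x : M, TangentSpace I x} {x : M} (hY : MDiffAt (T% Y) x) :
    MDiffAt (T% (fun y => 𝒥.J y (Y y))) x :=
  MDifferentiableAt.clm_bundle_apply (F₁ := E) (E₁ := fun y : M => TangentSpace I y)
    (F₂ := E) (E₂ := fun y : M => TangentSpace I y) (b := fun y => y)
    (𝒥.contMDiff.mdifferentiable (by simp) x) hY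

theorem tensorial_nablaJ (x : M) :
    TensorialAt I E (fun Y : Π x : M, TangentSpace I x =>
      leviCivita I M (fun y => 𝒥.J y (Y y)) x - (𝒥.J x).comp (leviCivita I M Y x)) x where
  smul {f Y} hf hY := by
    have h := (leviCivita I M).isCovariantDerivativeOnUniv.leibniz
      (𝒥.mdifferentiableAt_apply hY) hf
    have h' := (leviCivita I M).isCovariantDerivativeOnUniv.leibniz hY hf
    have e : (fun y => 𝒥.J y ((f • Y) y)) = f • fun y => 𝒥.J y (Y y) := by
      ext y; simp
    rw [e, h, h']
    ext v
    simp [smul_sub]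
  add {Y Y'} hY hY' := by
    have h := (leviCivita I M).isCovariantDerivativeOnUniv.add
      (𝒥.mdifferentiableAt_apply hY) (𝒥.mdifferentiableAt_apply hY')
    have h' := (leviCivita I M).isCovariantDerivativeOnUniv.add hY hY'
    have e : (fun y => 𝒥.J y ((Y + Y') y)) =
        (fun y => 𝒥.J y (Y y)) + fun y => 𝒥.J y (Y' y) := by
      ext y; simp
    rw [e, h, h']
    ext v
    simp
    abel

/-- The tensor `∇J`: `𝒥.nablaJ x u v` is `(∇_u J) v = ∇_u (J V) - J (∇_u V)`, where the vector field
`V` extends `v`. -/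
def nablaJ (x : M) : TangentSpace I x →L[ℝ] TangentSpace I x →L[ℝ] TangentSpace I x :=
  (TensorialAt.mkHom (I := I) (F := E) (fun Y : Π x : M, TangentSpace I x =>
    leviCivita I M (fun y => 𝒥.J y (Y y)) x - (𝒥.J x).comp (leviCivita I M Y x)) x
    (𝒥.tensorial_nablaJ x)).flip

theorem nablaJ_apply {Y : Π x : M, TangentSpace I x} {x : M} (hY : MDiffAt (T% Y) x)
    (u : TangentSpace I x) :
    𝒥.nablaJ x u (Y x) =
      leviCivita I M (fun y => 𝒥.J y (Y y)) x u - 𝒥.J x (leviCivita I M Y x u) := by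
  have h := TensorialAt.mkHom_apply (𝒥.tensorial_nablaJ x) hY
  exact congr($h u)

/-- `(M, g, J)` is nearly Kähler: `(∇_X J) X = 0` for all `X`. -/
def IsNearlyKahler : Prop :=
  ∀ (x : M) (u : TangentSpace I x), 𝒥.nablaJ x u u = 0

/-- Strictness: `∇_X J ≠ 0` for every tangent vector `X ≠ 0`. -/
def IsStrict : Prop :=
  ∀ (x : M) (u : TangentSpace I x), u ≠ 0 → 𝒥.nablaJ x u ≠ 0

/-- The star-Ricci tensor `Ric*(u, v) = 1/2 ∑ₖ R(u, Jv, eₖ, Jeₖ)`, for an orthonormal basis `(eₖ)`. -/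
def starRicci (x : M) (u v : TangentSpace I x) : ℝ :=
  (1 / 2 : ℝ) * ∑ k, curvature I x u (𝒥.J x v) (stdOrthonormalBasis ℝ (TangentSpace I x) k)
    (𝒥.J x (stdOrthonormalBasis ℝ (TangentSpace I x) k))

/-- The tensor `r` with `⟪r u, v⟫ = ∑ₖ ⟪(∇_{eₖ} J) u, (∇_{eₖ} J) v⟫`, for an orthonormal basis
`(eₖ)`. -/
def r (x : M) : TangentSpace I x →L[ℝ] TangentSpace I x :=
  ofForm (∑ k, (innerSL ℝ).bilinearComp
    (𝒥.nablaJ x (stdOrthonormalBasis ℝ (TangentSpace I x) k))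
    (𝒥.nablaJ x (stdOrthonormalBasis ℝ (TangentSpace I x) k)))

theorem inner_r (x : M) (u v : TangentSpace I x) :
    inner ℝ (𝒥.r x u) v =
      ∑ k, inner ℝ (𝒥.nablaJ x (stdOrthonormalBasis ℝ (TangentSpace I x) k) u)
        (𝒥.nablaJ x (stdOrthonormalBasis ℝ (TangentSpace I x) k) v) := by
  simp [r, inner_ofForm]

/-- The eigenspace at `x` of `r` for the real number `c`; for an eigenvalue `c` of `r` these are the
fibres of the corresponding eigenbundle. -/
def eigenspace (x : M) (c : ℝ) : Submodule ℝ (TangentSpace I x) :=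
  Module.End.eigenspace (𝒥.r x : TangentSpace I x →ₗ[ℝ] TangentSpace I x) c

/-- The endomorphism `S` of the tangent space at `x` with
`⟪S u, v⟫ = -Tr_W ((∇_u J) (∇_v J))`. -/
def rPart (x : M) (W : Submodule ℝ (TangentSpace I x)) :
    TangentSpace I x →L[ℝ] TangentSpace I x :=
  ofForm (LinearMap.toContinuousBilinearMap (LinearMap.mk₂ ℝ
    (fun u v => -traceOn W ((𝒥.nablaJ x u).comp (𝒥.nablaJ x v)))
    (by intro u u' v; simp [traceOn, inner_add_left, Finset.sum_add_distrib]; ring)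
    (by intro c u v; simp [traceOn, inner_smul_left, Finset.mul_sum])
    (by intro u v v'; simp [traceOn, inner_add_left, Finset.sum_add_distrib]; ring)
    (by intro c u v; simp [traceOn, inner_smul_left, Finset.mul_sum])))

theorem inner_rPart (x : M) (W : Submodule ℝ (TangentSpace I x)) (u v : TangentSpace I x) :
    inner ℝ (𝒥.rPart x W u) v = -traceOn W ((𝒥.nablaJ x u).comp (𝒥.nablaJ x v)) := by
  simp [rPart, inner_ofForm]

end AlmostHermitian

end

end NearlyKahler

/-! Write Ψ = ∇J, which is totally skew and anticommutes with J, and let ∇̄ = ∇ - ½JΨ be the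
canonical Hermitian connection. It preserves g and J, and its torsion is built from Ψ. The engine is
Kirichenko's theorem ∇̄Ψ = 0 (`Calculus.alpha_eq_zero`). Comparing R with J gives R(W,X,Y,Z) -
R(W,X,JY,JZ) = ⟨Ψ(W,X),Ψ(Y,Z)⟩ plus terms in ∇̄Ψ, and the symmetries of R force the latter to
vanish. Contracting what remains gives ⟨r·,·⟩ = Ric - Ric*.

Since J and Ψ are ∇̄-parallel, the curvature Q of ∇̄ commutes with J and acts on Ψ as a derivation.
It differs from R by terms quadratic in Ψ, so Ric = ric + ¼r, where ric is the Ricci form of Q. As r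
= -∑ Ψ_{e_k}Ψ_{e_k}, the derivation property and the Bianchi identity with torsion yield ric(z, r w)
= ∑ ⟨Ψ_z e_i, Ψ_w r e_i⟩ (`PointModel.ric_r`). The right side is symmetric in z and w, so ric
commutes with r; this gives (i). On an eigenspace, evaluating the sum in a basis adapted to the
eigenspaces of r gives (ii).

Finally g and Ψ are ∇̄-parallel, hence so is r (`AlmostHermitian.nb_rVF`). The traces of all
polynomials in r are then locally constant, which on a connected manifold makes the spectrum of r
independent of the point. Strictness makes it positive. -/

/-! ### The linear algebra behind Kirichenko's theorem -/

namespace NearlyKahler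

-- Here `R` is an algebraic curvature tensor whose failure to be J-invariant is measured by `a`. The
-- first Bianchi identity is taken for all eight ways of inserting J in an even number of slots.
-- `H1`, `H2` and the symmetries relate these eight, and a linear combination eliminates `R` and
-- leaves `a w x y z`. All that is needed of J is contained in the hypotheses, so no linearity is
-- assumed.
set_option maxRecDepth 10000 in
set_option maxHeartbeats 2000000 in
theorem eq_zero_of_curvature_eq {V : Type*} (J : V → V) (R a : V → V → V → V → ℝ)
    (s34 : ∀ w x y z, R w x y z = -R w x z y)
    (pr : ∀ w x y z, R w x y z = R y z w x)
    (bi : ∀ w x y z, R w x y z + R w y z x + R w z x y = 0)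
    (H1 : ∀ w x y z, R w x y z - R w x (J y) (J z) = a x w y z - a w x y z)
    (H2 : ∀ w x y z, R w x (J y) z + R w x y (J z) = a x w (J y) z - a w x (J y) z)
    (a12 : ∀ w x y z, a w x y z = -a w y x z) (a23 : ∀ w x y z, a w x y z = -a w x z y)
    (aJ2 : ∀ w x y z, a w x (J y) z = a w (J x) y z)
    (aJ3 : ∀ w x y z, a w x y (J z) = a w (J x) y z)
    (aJJ : ∀ w x y z, a w (J (J x)) y z = -a w x y z) (w x y z : V) : a w x y z = 0 := by
  linarith [H2 w (J z) x y, aJ2 (J z) w x y, a12 w (J z) (J x) y, a23 w (J x) (J z) y,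
    aJ3 w (J x) y z, aJJ w x y z, H2 x (J y) w z, pr x (J y) (J w) z,
    pr x (J y) w (J z), a12 (J y) x (J w) z, a12 x (J y) (J w) z, aJ2 x (J w) y z,
    aJJ x w y z, H1 w y x z, a12 w y x z, H1 x z w y,
    pr x z w y, pr x z (J w) (J y), a12 z x w y, a12 x z w y,
    a23 x w z y, H2 w (J x) y z, aJ2 (J x) w y z, aJ2 w (J x) y z,
    H2 (J y) z w x, pr (J y) z (J w) x, pr (J y) z w (J x), a12 z (J y) (J w) x,
    a23 z (J w) (J y) x, aJ3 z (J w) x y, aJJ z w x y, a12 (J y) z (J w) x,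
    a23 (J y) (J w) z x, H2 x (J z) w y, pr x (J z) (J w) y, pr x (J z) w (J y),
    a12 (J z) x (J w) y, a12 x (J z) (J w) y, a23 x (J w) (J z) y, aJ3 x (J w) y z,
    H2 w (J y) x z, aJ2 (J y) w x z, a12 w (J y) (J x) z, H1 (J y) (J z) w x,
    pr (J y) (J z) w x, pr (J y) (J z) (J w) (J x), a12 (J z) (J y) w x, a23 (J z) w (J y) x,
    aJ3 (J z) w x y, a12 (J y) (J z) w x, a23 (J y) w (J z) x, aJ3 (J y) w x z,
    H2 (J x) y w z, pr (J x) y (J w) z, pr (J x) y w (J z), a12 y (J x) (J w) z,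
    aJ2 y (J w) x z, aJJ y w x z, a12 (J x) y (J w) z, H2 (J w) z x y,
    aJ2 z (J w) x y, a12 (J w) z (J x) y, a23 (J w) (J x) z y, H1 w x y z,
    H1 w z x y, a12 w z x y, a23 w x z y, H1 y z w x,
    pr y z w x, pr y z (J w) (J x), a12 z y w x, a23 z w y x,
    a12 y z w x, a23 y w z x, H2 (J x) z w y, pr (J x) z (J w) y,
    pr (J x) z w (J y), a12 z (J x) (J w) y, a12 (J x) z (J w) y, a23 (J x) (J w) z y,
    H2 y (J z) w x, pr y (J z) (J w) x, pr y (J z) w (J x), a12 (J z) y (J w) x,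
    a23 (J z) (J w) y x, a12 y (J z) (J w) x, a23 y (J w) (J z) x, aJ3 y (J w) x z,
    H1 (J w) (J z) x y, a12 (J w) (J z) x y, a23 (J w) x (J z) y, aJ3 (J w) x y z,
    H1 (J x) (J z) w y, pr (J x) (J z) w y, pr (J x) (J z) (J w) (J y), a12 (J z) (J x) w y,
    a12 (J x) (J z) w y, a23 (J x) w (J z) y, aJ3 (J x) w y z,
    bi w x y z, s34 w y z x, bi w x (J y) (J z), s34 w (J y) (J z) x,
    bi w (J x) y (J z), s34 w y (J z) (J x), bi w (J x) (J y) z, s34 w (J y) z (J x),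
    bi (J w) x y (J z), s34 (J w) y (J z) x, bi (J w) x (J y) z, s34 (J w) (J y) z x,
    bi (J w) (J x) y z, s34 (J w) y z (J x), bi (J w) (J x) (J y) (J z), s34 (J w) (J y) (J z) (J x)]

/-- The algebraic calculus of vector fields on a nearly Kähler manifold: `𝔛` stands for the vector
fields, `C` for the functions, `D X f` for the derivative of `f` along `X`. -/
structure Calculus (𝔛 C : Type*) [AddCommGroup 𝔛] [Module ℝ 𝔛] [AddCommGroup C] [Module ℝ C] where
  D : 𝔛 → C →ₗ[ℝ] C
  g : 𝔛 →ₗ[ℝ] 𝔛 →ₗ[ℝ] C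
  nabla : 𝔛 →ₗ[ℝ] 𝔛 →ₗ[ℝ] 𝔛
  J : 𝔛 →ₗ[ℝ] 𝔛
  g_comm : ∀ X Y, g X Y = g Y X
  ext_g : ∀ X Y, (∀ Z, g X Z = g Y Z) → X = Y
  D_g : ∀ X Y Z, D X (g Y Z) = g (nabla X Y) Z + g Y (nabla X Z)
  J_J : ∀ X, J (J X) = -X
  g_J_J : ∀ X Y, g (J X) (J Y) = g X Y
  nabla_J_self : ∀ X, nabla X (J X) = J (nabla X X)
  D_bracket : ∀ X Y f, D (nabla X Y - nabla Y X) f = D X (D Y f) - D Y (D X f)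
  jacobi : ∀ X Y Z,
    nabla X (nabla Y Z - nabla Z Y) - nabla (nabla Y Z - nabla Z Y) X =
      nabla (nabla X Y - nabla Y X) Z - nabla Z (nabla X Y - nabla Y X)
        + (nabla Y (nabla X Z - nabla Z X) - nabla (nabla X Z - nabla Z X) Y)

/-! ### The canonical Hermitian connection and its curvature -/

namespace Calculus

variable {𝔛 C : Type*} [AddCommGroup 𝔛] [Module ℝ 𝔛] [AddCommGroup C] [Module ℝ C]
  (K : Calculus 𝔛 C)

/-- The tensor `∇J`. -/
def Psi : 𝔛 →ₗ[ℝ] 𝔛 →ₗ[ℝ] 𝔛 := K.nabla.compl₂ K.J - K.nabla.compr₂ K.J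

theorem Psi_apply (X Y : 𝔛) : K.Psi X Y = K.nabla X (K.J Y) - K.J (K.nabla X Y) := rfl

/-- The canonical Hermitian connection. -/
noncomputable def nb : 𝔛 →ₗ[ℝ] 𝔛 →ₗ[ℝ] 𝔛 := K.nabla - (1 / 2 : ℝ) • K.Psi.compr₂ K.J

theorem nb_apply (X Y : 𝔛) : K.nb X Y = K.nabla X Y - (1 / 2 : ℝ) • K.J (K.Psi X Y) := rfl

theorem nabla_eq (X Y : 𝔛) : K.nabla X Y = K.nb X Y + (1 / 2 : ℝ) • K.J (K.Psi X Y) := by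
  rw [nb_apply]; abel

theorem Psi_self (X : 𝔛) : K.Psi X X = 0 := by
  rw [Psi_apply, K.nabla_J_self, sub_self]

theorem Psi_swap (X Y : 𝔛) : K.Psi X Y = -K.Psi Y X := by
  have h := K.Psi_self (X + Y)
  simp only [map_add, LinearMap.add_apply, Psi_self, zero_add, add_zero] at h
  exact eq_neg_of_add_eq_zero_right h

theorem g_J (X Y : 𝔛) : K.g (K.J X) Y = -K.g X (K.J Y) := by
  rw [← K.g_J_J X (K.J Y), K.J_J]; simp

theorem Psi_J (X Y : 𝔛) : K.Psi X (K.J Y) = -K.J (K.Psi X Y) := by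
  simp only [Psi_apply, map_sub, K.J_J, map_neg]; abel

theorem Psi_J_left (X Y : 𝔛) : K.Psi (K.J X) Y = -K.J (K.Psi X Y) := by
  rw [Psi_swap, Psi_J, K.Psi_swap Y X]; simp

theorem g_Psi (X Y Z : 𝔛) : K.g (K.Psi X Y) Z = -K.g Y (K.Psi X Z) := by
  have h1 := K.D_g X (K.J Y) Z
  have h2 := K.D_g X Y (K.J Z)
  rw [K.g_J, map_neg, h2] at h1
  simp only [Psi_apply, map_sub, LinearMap.sub_apply]
  rw [K.g_J (K.nabla X Y)]
  rw [K.g_J Y] at h1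
  linear_combination (norm := module) -h1

theorem nb_J (X Y : 𝔛) : K.nb X (K.J Y) = K.J (K.nb X Y) := by
  simp only [nb_apply, Psi_J, map_sub, map_smul, map_neg, K.J_J]
  rw [Psi_apply]; module

theorem D_g_nb (X Y Z : 𝔛) : K.D X (K.g Y Z) = K.g (K.nb X Y) Z + K.g Y (K.nb X Z) := by
  rw [K.D_g, nabla_eq, nabla_eq]
  simp only [map_add, LinearMap.add_apply, map_smul, LinearMap.smul_apply]
  rw [K.g_J, K.g_Psi, Psi_J, map_neg]
  module

/-- The derivative of `∇J` with respect to the canonical connection. -/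
noncomputable def alpha (W X Y : 𝔛) : 𝔛 :=
  K.nb W (K.Psi X Y) - K.Psi (K.nb W X) Y - K.Psi X (K.nb W Y)

theorem alpha_swap (W X Y : 𝔛) : K.alpha W X Y = -K.alpha W Y X := by
  simp only [alpha]
  rw [K.Psi_swap X Y, K.Psi_swap (K.nb W X) Y, K.Psi_swap X (K.nb W Y), map_neg]; abel

theorem g_alpha (W X Y Z : 𝔛) : K.g (K.alpha W X Y) Z = -K.g Y (K.alpha W X Z) := by
  have h1 := K.D_g_nb W (K.Psi X Y) Z
  have h2 := K.D_g_nb W Y (K.Psi X Z)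
  rw [K.g_Psi, map_neg, h2] at h1
  simp only [alpha, map_sub, LinearMap.sub_apply]
  simp only [K.g_Psi] at h1 ⊢
  linear_combination (norm := module) -h1

theorem alpha_J (W X Y : 𝔛) : K.alpha W X (K.J Y) = -K.J (K.alpha W X Y) := by
  simp only [alpha, nb_J, Psi_J, map_neg, map_sub]; abel

theorem alpha_J_left (W X Y : 𝔛) : K.alpha W (K.J X) Y = -K.J (K.alpha W X Y) := by
  rw [alpha_swap, alpha_J, K.alpha_swap W Y X, map_neg, neg_neg]

/-- The curvature operator of the Levi-Civita connection. -/
def R (X Y Z : 𝔛) : 𝔛 :=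
  K.nabla X (K.nabla Y Z) - K.nabla Y (K.nabla X Z) - K.nabla (K.nabla X Y - K.nabla Y X) Z

/-- The curvature form, with the sign for which it gives the sectional curvature. -/
def Rm (X Y Z W : 𝔛) : C := -K.g (K.R X Y Z) W

theorem R_swap (X Y Z : 𝔛) : K.R X Y Z = -K.R Y X Z := by
  simp only [R, map_sub, LinearMap.sub_apply]; abel

theorem R_bianchi (X Y Z : 𝔛) : K.R X Y Z + K.R Y Z X + K.R Z X Y = 0 := by
  have h := K.jacobi X Y Z
  simp only [map_sub, LinearMap.sub_apply] at h
  simp only [R, map_sub, LinearMap.sub_apply]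
  linear_combination (norm := module) h

theorem Rm_swap_left (X Y Z W : 𝔛) : K.Rm X Y Z W = -K.Rm Y X Z W := by
  rw [Rm, R_swap]; simp [Rm]

theorem Rm_bianchi (X Y Z W : 𝔛) : K.Rm X Y Z W + K.Rm Y Z X W + K.Rm Z X Y W = 0 := by
  have h := congrArg (fun V => K.g V W) (K.R_bianchi X Y Z)
  simp only [map_add, LinearMap.add_apply, map_zero, LinearMap.zero_apply] at h
  simp only [Rm]
  linear_combination (norm := module) -h

theorem Rm_swap_right (X Y Z W : 𝔛) : K.Rm X Y Z W = -K.Rm X Y W Z := by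
  have h := K.D_bracket X Y (K.g Z W)
  simp only [K.D_g, map_add] at h
  simp only [Rm, R, map_sub, LinearMap.sub_apply] at h ⊢
  rw [K.g_comm _ Z, K.g_comm _ Z, K.g_comm _ Z, K.g_comm _ Z]
  linear_combination (norm := module) h

theorem Rm_pair (X Y Z W : 𝔛) : K.Rm X Y Z W = K.Rm Z W X Y := by
  have h1 := K.Rm_bianchi X Y Z W
  have h2 := K.Rm_bianchi Y Z W X
  have h3 := K.Rm_bianchi Z W X Y
  have h4 := K.Rm_bianchi W X Y Z
  rw [K.Rm_swap_right Y Z W X, K.Rm_swap_right Z W Y X] at h2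
  rw [K.Rm_swap_right W X Z Y, K.Rm_swap_left X Z W Y, K.Rm_swap_right Z X W Y] at h3
  rw [K.Rm_swap_right X Y W Z, K.Rm_swap_left Y W X Z, K.Rm_swap_right W Y X Z] at h4
  linear_combination (norm := module) (1 / 2 : ℝ) • (h1 + h2 - h3 - h4)

/-- Expand R with ∇ = ∇̄ + ½JΨ. The part of R(W,X) commuting with J cancels and the anticommuting
part doubles. The latter consists of the derivatives of Ψ, which give `alpha`, and of the torsion
JΨ(W,X) inside the bracket, which gives the quadratic term. -/
theorem R_add_J_R_J (W X Y : 𝔛) :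
    K.R W X Y + K.J (K.R W X (K.J Y)) =
      K.J (K.alpha W X Y - K.alpha X W Y) - K.Psi (K.Psi W X) Y := by
  simp only [R, nabla_eq, map_add, map_sub, map_neg, map_smul, LinearMap.add_apply,
    LinearMap.sub_apply, LinearMap.smul_apply, nb_J, Psi_J, Psi_J_left, K.J_J, alpha,
    K.Psi_swap X W]
  simp only [map_neg, map_add, map_smul, LinearMap.neg_apply, nabla_eq, nb_J, Psi_J, Psi_J_left, K.J_J]
  module

theorem Rm_sub_Rm_J_J (W X Y Z : 𝔛) :
    K.Rm W X Y Z - K.Rm W X (K.J Y) (K.J Z) =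
      K.g (K.Psi W X) (K.Psi Y Z)
        - (K.g (K.J (K.alpha W X Y)) Z - K.g (K.J (K.alpha X W Y)) Z) := by
  have h := congrArg (fun V => K.g V Z) (K.R_add_J_R_J W X Y)
  simp only [map_add, map_sub, LinearMap.add_apply, LinearMap.sub_apply] at h
  rw [K.g_J (K.R _ _ _), K.Psi_swap _ Y, map_neg, LinearMap.neg_apply, K.g_Psi Y] at h
  simp only [Rm]
  linear_combination (norm := module) -h

/-- Kirichenko's theorem: `∇J` is parallel for the canonical connection. -/
theorem alpha_eq_zero (W X Y : 𝔛) : K.alpha W X Y = 0 := by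
  have hJ : K.J (K.alpha W X Y) = 0 := by
    refine K.ext_g _ _ fun Z => ?_
    -- `C` is only a real vector space. Testing against linear functionals makes all forms
    -- real-valued, as `eq_zero_of_curvature_eq` requires.
    rw [map_zero, LinearMap.zero_apply, ← Module.forall_dual_apply_eq_zero_iff ℝ]
    intro φ
    let P : 𝔛 → 𝔛 → 𝔛 → 𝔛 → ℝ := fun w x y z => φ (K.g (K.Psi w x) (K.Psi y z))
    have P12 : ∀ w x y z, P w x y z = -P x w y z := fun w x y z => by
      simp only [P]; rw [K.Psi_swap w x]; simp
    have P34 : ∀ w x y z, P w x y z = -P w x z y := fun w x y z => by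
      simp only [P]; rw [K.Psi_swap y z]; simp
    have Ppr : ∀ w x y z, P w x y z = P y z w x := fun w x y z => by
      simp only [P]; rw [K.g_comm]
    have PJ : ∀ w x y z, P w x (K.J y) (K.J z) = -P w x y z := fun w x y z => by
      simp only [P, K.Psi_J, K.Psi_J_left]; simp [K.J_J]
    have PJ' : ∀ w x y z, P w (K.J x) y (K.J z) = P w x y z := fun w x y z => by
      simp only [P, K.Psi_J]; simp [K.g_J_J]
    have aJ : ∀ w x y, K.alpha w x (K.J y) = K.alpha w (K.J x) y := fun w x y => by
      rw [alpha_J, alpha_J_left]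
    -- The subtracted quadratic expression is itself an algebraic curvature tensor: its cyclic sum
    -- vanishes because ½ - ¼ - ¼ = 0. Its J-defect is exactly `P w x y z`, so only the `alpha`
    -- terms survive in the defect of the corrected tensor.
    have H1 : ∀ w x y z, (φ (K.Rm w x y z) - (1 / 2 * P w x y z - 1 / 4 * (P x y w z + P y w x z)))
        - (φ (K.Rm w x (K.J y) (K.J z)) - (1 / 2 * P w x (K.J y) (K.J z)
          - 1 / 4 * (P x (K.J y) w (K.J z) + P (K.J y) w x (K.J z))))
        = φ (K.g (K.J (K.alpha x w y)) z) - φ (K.g (K.J (K.alpha w x y)) z) := fun w x y z => by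
      have h := congrArg φ (K.Rm_sub_Rm_J_J w x y z)
      simp only [map_sub] at h
      change _ = P w x y z - _ at h
      rw [P12 (K.J y), PJ, PJ', PJ', P12 w y]
      linarith
    refine eq_zero_of_curvature_eq K.J
      (fun w x y z => φ (K.Rm w x y z) - (1 / 2 * P w x y z - 1 / 4 * (P x y w z + P y w x z)))
      (fun w x y z => φ (K.g (K.J (K.alpha w x y)) z)) ?_ ?_ ?_ H1 ?_ ?_ ?_ ?_ ?_ ?_ W X Y Z
    · intro w x y z
      rw [K.Rm_swap_right, map_neg]
      linarith [P34 w x z y, Ppr x z w y, P12 z w x y, Ppr x y w z, P12 y w x z]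
    · intro w x y z
      rw [K.Rm_pair]
      linarith [Ppr w x y z, P12 x y w z, P34 y x w z, Ppr y x z w, P12 y w x z, P34 w y x z,
        Ppr w y z x, P34 x y w z, P34 y w x z, Ppr x y z w, P12 z w x y, Ppr x y w z, Ppr w y x z,
        P12 x z w y, Ppr z x w y, P12 w y x z, P34 w z x y, P12 w z x y, Ppr z w x y]
    · intro w x y z
      have h := congrArg φ (K.Rm_bianchi x y z w)
      rw [K.Rm_swap_right x y, K.Rm_swap_right y z, K.Rm_swap_right z x, K.Rm_pair x y,
        K.Rm_pair y z, K.Rm_pair z x] at h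
      simp only [map_add, map_neg, map_zero] at h
      linarith [Ppr x y w z, P12 y w x z, P34 w y z x, Ppr y z w x, P12 z w y x, P34 w z y x,
        Ppr z x w y, P12 x w z y, P34 w x z y]
    -- This is `H1` with y replaced by J y, using J J y = -y.
    · intro w x y z
      have h := H1 w x (K.J y) z
      have e1 : K.Rm w x (-y) (K.J z) = -K.Rm w x y (K.J z) := by simp [Rm, R]; abel
      have e2 : ∀ u v t, P u v (-y) t = -P u v y t := fun u v t => by simp [P]
      have e3 : ∀ u v t, P u (-y) v t = -P u y v t := fun u v t => by simp [P]
      have e4 : ∀ u v t, P (-y) u v t = -P y u v t := fun u v t => by simp [P]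
      rw [K.J_J, e1, e2, e3, e4, map_neg] at h
      linarith
    · intro w x y z
      rw [alpha_swap]; simp
    · intro w x y z
      simp only [K.g_J]
      rw [K.g_alpha, alpha_J, map_neg, K.g_comm y]
      simp only [map_neg, LinearMap.neg_apply, K.g_J, neg_neg]
    · intro w x y z
      simp only [aJ]
    · intro w x y z
      rw [← aJ, alpha_J, map_neg, map_neg, LinearMap.neg_apply, K.g_J (K.J _), neg_neg]
    · intro w x y z
      rw [K.J_J, K.alpha_swap w (-x) y, K.alpha_swap w x y]
      simp only [alpha, map_neg, map_sub, LinearMap.neg_apply, LinearMap.sub_apply]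
      ring
  have := K.J_J (K.alpha W X Y)
  rw [hJ, map_zero] at this
  exact neg_eq_zero.mp this.symm

theorem nb_Psi (W X Y : 𝔛) :
    K.nb W (K.Psi X Y) = K.Psi (K.nb W X) Y + K.Psi X (K.nb W Y) := by
  have h := K.alpha_eq_zero W X Y
  rw [alpha] at h
  linear_combination (norm := module) h

/-- The curvature operator of the canonical connection. -/
noncomputable def Rb (X Y Z : 𝔛) : 𝔛 :=
  K.R X Y Z + (1 / 2 : ℝ) • K.Psi (K.Psi X Y) Z
    - (1 / 4 : ℝ) • (K.Psi X (K.Psi Y Z) - K.Psi Y (K.Psi X Z))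

/-- `Rb` was defined by its difference from `R`, which is what comparing Ricci forms needs. As a
genuine curvature operator it inherits the parallelism of J and Ψ. The computation rests on
`nb_Psi`. -/
theorem Rb_eq (X Y Z : 𝔛) :
    K.Rb X Y Z = K.nb X (K.nb Y Z) - K.nb Y (K.nb X Z)
      - K.nb (K.nabla X Y - K.nabla Y X) Z := by
  rw [Rb, R]
  generalize hB : K.nabla X Y - K.nabla Y X = B
  have hB' : B = K.nb X Y - K.nb Y X + K.J (K.Psi X Y) := by
    rw [← hB, nabla_eq, nabla_eq, K.Psi_swap Y X, map_neg]; module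
  have h : K.Psi B Z = K.Psi (K.nb X Y) Z - K.Psi (K.nb Y X) Z - K.J (K.Psi (K.Psi X Y) Z) := by
    rw [hB']
    simp only [map_add, map_sub, LinearMap.add_apply, LinearMap.sub_apply, Psi_J_left]
    abel
  simp only [nabla_eq, map_add, map_smul, nb_J, nb_Psi, Psi_J, h, map_sub, K.J_J, map_neg]
  module

/-- The curvature of a connection acts as a derivation on every parallel tensor. -/
theorem Rb_Psi (X Y Z W : 𝔛) :
    K.Rb X Y (K.Psi Z W) = K.Psi (K.Rb X Y Z) W + K.Psi Z (K.Rb X Y W) := by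
  simp only [Rb_eq, nb_Psi, map_add, map_sub, LinearMap.sub_apply]
  abel

theorem Rb_J (X Y Z : 𝔛) : K.Rb X Y (K.J Z) = K.J (K.Rb X Y Z) := by
  simp only [Rb_eq, nb_J, map_sub, LinearMap.sub_apply]

theorem Rm_sub_Rm_J (W X Y Z : 𝔛) :
    K.Rm W X Y Z - K.Rm W X (K.J Y) (K.J Z) = K.g (K.Psi W X) (K.Psi Y Z) := by
  rw [Rm_sub_Rm_J_J]; simp [alpha_eq_zero]

/-- The curvature form of the canonical connection. -/
noncomputable def Qm (X Y Z W : 𝔛) : C := -K.g (K.Rb X Y Z) W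

theorem Qm_eq (X Y Z W : 𝔛) :
    K.Qm X Y Z W = K.Rm X Y Z W - (1 / 2 : ℝ) • K.g (K.Psi X Y) (K.Psi Z W)
      + (1 / 4 : ℝ) • (K.g (K.Psi X Z) (K.Psi Y W) - K.g (K.Psi Y Z) (K.Psi X W)) := by
  have h1 : K.g (K.Psi (K.Psi X Y) Z) W = K.g (K.Psi X Y) (K.Psi Z W) := by
    rw [K.Psi_swap, map_neg, LinearMap.neg_apply, K.g_Psi, neg_neg]
  simp only [Qm, Rb, Rm, map_add, map_sub, map_smul, LinearMap.add_apply, LinearMap.sub_apply,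
    LinearMap.smul_apply, h1, K.g_Psi X (K.Psi Y Z), K.g_Psi Y (K.Psi X Z)]
  module

theorem Qm_Psi (X Y Z W V : 𝔛) :
    K.Qm X Y (K.Psi Z W) V = K.Qm X Y Z (K.Psi W V) - K.Qm X Y W (K.Psi Z V) := by
  have h1 : K.g (K.Psi (K.Rb X Y Z) W) V = K.g (K.Rb X Y Z) (K.Psi W V) := by
    rw [K.Psi_swap, map_neg, LinearMap.neg_apply, K.g_Psi, neg_neg]
  simp only [Qm, Rb_Psi, map_add, LinearMap.add_apply, h1, K.g_Psi Z]
  abel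

theorem Qm_J_J (X Y Z W : 𝔛) : K.Qm X Y (K.J Z) (K.J W) = K.Qm X Y Z W := by
  simp only [Qm, Rb_J, K.g_J_J]

end Calculus
end NearlyKahler

/-! ### Contractions at a point and the Ricci form of the canonical connection -/

namespace NearlyKahler

section Contraction

variable {V : Type*} [NormedAddCommGroup V] [InnerProductSpace ℝ V]
  {ι : Type*} [Fintype ι] (e : OrthonormalBasis ι ℝ V)

/-- In coordinates both sides are the same double sum. Adjointness is used only on basis vectors, so
`T` and `S` need not be linear. -/
theorem sum_apply_adjoint (F : V →ₗ[ℝ] V →ₗ[ℝ] ℝ) (T S : V → V)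
    (h : ∀ i j, inner ℝ (T (e i)) (e j) = inner ℝ (e i) (S (e j))) :
    ∑ i, F (T (e i)) (e i) = ∑ i, F (e i) (S (e i)) := by
  have h1 : ∀ i, F (T (e i)) (e i) = ∑ j, inner ℝ (e j) (T (e i)) * F (e j) (e i) := fun i => by
    conv_lhs => rw [← e.sum_repr' (T (e i))]
    simp
  have h2 : ∀ i, F (e i) (S (e i)) = ∑ j, inner ℝ (e j) (S (e i)) * F (e i) (e j) := fun i => by
    conv_lhs => rw [← e.sum_repr' (S (e i))]
    simp
  simp only [h1, h2]
  rw [Finset.sum_comm]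
  refine Finset.sum_congr rfl fun i _ => Finset.sum_congr rfl fun j _ => ?_
  rw [real_inner_comm, h]

/-- Allows the chosen basis in the definitions to be exchanged for a smooth frame or a basis adapted
to the eigenspaces. -/
theorem sum_apply_apply_eq {κ : Type*} [Fintype κ] (f : OrthonormalBasis κ ℝ V)
    (F : V →ₗ[ℝ] V →ₗ[ℝ] ℝ) : ∑ i, F (e i) (e i) = ∑ k, F (f k) (f k) := by
  have h1 : ∀ i, F (e i) (e i) = ∑ k, inner ℝ (f k) (e i) * F (f k) (e i) := fun i => by
    have h := congrArg (fun v => F v (e i)) (f.sum_repr' (e i))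
    simpa using h.symm
  have h2 : ∀ k, F (f k) (f k) = ∑ i, inner ℝ (e i) (f k) * F (f k) (e i) := fun k => by
    have h := congrArg (fun v => F (f k) v) (e.sum_repr' (f k))
    simpa using h.symm
  simp only [h1, h2]
  rw [Finset.sum_comm]
  simp only [real_inner_comm]

end Contraction

/-- The pointwise data at a point of a nearly Kähler manifold: `Psi` is `∇J` and `Q` is the curvature
form of the canonical connection. -/
structure PointModel (V : Type*) [NormedAddCommGroup V] [InnerProductSpace ℝ V] where
  J : V →L[ℝ] V
  Psi : V →L[ℝ] V →L[ℝ] V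
  Q : V →ₗ[ℝ] V →ₗ[ℝ] V →ₗ[ℝ] V →ₗ[ℝ] ℝ
  J_J : ∀ u, J (J u) = -u
  inner_J_J : ∀ u v, inner ℝ (J u) (J v) = inner ℝ u v
  Psi_swap : ∀ u v, Psi u v = -Psi v u
  Psi_J : ∀ u v, Psi u (J v) = -J (Psi u v)
  inner_Psi : ∀ u v w, inner ℝ (Psi u v) w = -inner ℝ v (Psi u w)
  Q_swap_left : ∀ a b c d, Q a b c d = -Q b a c d
  Q_swap_right : ∀ a b c d, Q a b c d = -Q a b d c
  Q_pair : ∀ a b c d, Q a b c d = Q c d a b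
  Q_bianchi : ∀ a b c d, Q a b c d + Q b c a d + Q c a b d =
    -(inner ℝ (Psi a b) (Psi c d) + inner ℝ (Psi b c) (Psi a d) + inner ℝ (Psi c a) (Psi b d))
  Q_Psi : ∀ a b c d f, Q a b (Psi c d) f = Q a b c (Psi d f) - Q a b d (Psi c f)
  Q_J_J : ∀ a b c d, Q a b (J c) (J d) = Q a b c d

namespace PointModel

variable {V : Type*} [NormedAddCommGroup V] [InnerProductSpace ℝ V] (P : PointModel V)
  {ι : Type*} [Fintype ι] (e : OrthonormalBasis ι ℝ V)

theorem Psi_J_left (u v : V) : P.Psi (P.J u) v = -P.J (P.Psi u v) := by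
  rw [P.Psi_swap, P.Psi_J, P.Psi_swap v u]; simp

theorem inner_J (u v : V) : inner ℝ (P.J u) v = inner ℝ u (-P.J v) := by
  rw [← P.inner_J_J u, map_neg, P.J_J, neg_neg]

theorem inner_Psi_Psi (u v a b : V) :
    inner ℝ (P.Psi u (P.Psi v a)) b = inner ℝ a (P.Psi v (P.Psi u b)) := by
  rw [P.inner_Psi, P.inner_Psi, neg_neg]

/-- Moving J across the contraction turns the sum into its own negative, since `F` is J-invariant
while `T` anticommutes with J. -/
theorem sum_apply_eq_zero (F : V →ₗ[ℝ] V →ₗ[ℝ] ℝ) (hF : ∀ u v, F (P.J u) (P.J v) = F u v)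
    (T : V →L[ℝ] V) (hT : ∀ u, T (P.J u) = -P.J (T u)) : ∑ i, F (e i) (T (e i)) = 0 := by
  have h := sum_apply_adjoint e (F.compl₂ (T.toLinearMap ∘ₗ P.J.toLinearMap)) P.J
    (fun u => -P.J u) (fun i j => P.inner_J _ _)
  simp only [LinearMap.compl₂_apply, LinearMap.comp_apply, ContinuousLinearMap.coe_coe, map_neg,
    P.J_J, neg_neg, hT, hF, Finset.sum_neg_distrib] at h
  linarith

/-- The Ricci form of the canonical connection. -/
noncomputable def ric (z w : V) : ℝ := ∑ i, P.Q z (e i) w (e i)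

theorem ric_comm (z w : V) : P.ric e z w = P.ric e w z := by
  simp only [ric]
  exact Finset.sum_congr rfl fun i _ => P.Q_pair _ _ _ _

variable {r : V →L[ℝ] V} (hr : ∀ u v, inner ℝ (r u) v = ∑ k, inner ℝ (P.Psi (e k) u) (P.Psi (e k) v))
include hr

theorem sum_Psi_Psi (w : V) : ∑ k, P.Psi (e k) (P.Psi (e k) w) = -r w := by
  refine ext_inner_right ℝ fun v => ?_
  rw [inner_neg_left, hr, sum_inner, ← Finset.sum_neg_distrib]
  exact Finset.sum_congr rfl fun i _ => P.inner_Psi _ _ _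

/-- After r w = -∑ Ψ_{e_j}Ψ_{e_j} w, the derivation property splits each summand in two. Skewness of
Ψ and of Q brings both pieces to the same sum, whence the factor 2. -/
theorem ric_r_eq_sum (z w : V) :
    P.ric e z (r w) = 2 * ∑ k, ∑ m, P.Q z (e k) (e m) (P.Psi w (P.Psi (e k) (e m))) := by
  have h1 : P.ric e z (r w) = ∑ k, ∑ j, P.Q z (e k) (e k) (P.Psi (e j) (P.Psi (e j) w)) := by
    refine Finset.sum_congr rfl fun k _ => ?_
    rw [← map_sum, P.sum_Psi_Psi e hr, map_neg, P.Q_swap_right]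
  rw [h1, Finset.mul_sum]
  refine Finset.sum_congr rfl fun k _ => ?_
  have h2 : ∀ j, P.Q z (e k) (e k) (P.Psi (e j) (P.Psi (e j) w)) =
      P.Q z (e k) (P.Psi (e k) (e j)) (P.Psi (e j) w)
        + P.Q z (e k) (e j) (P.Psi (e k) (P.Psi (e j) w)) := fun j => by
    have h := P.Q_Psi z (e k) (e j) (e k) (P.Psi (e j) w)
    rw [P.Psi_swap (e j) (e k), map_neg, LinearMap.neg_apply] at h
    linarith
  have h3 := sum_apply_adjoint e ((P.Q z (e k)).compl₂ (P.Psi w).toLinearMap) (P.Psi (e k))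
    (fun v => -P.Psi (e k) v) (fun i j => by rw [P.inner_Psi, inner_neg_right])
  have h4 := sum_apply_adjoint e (P.Q z (e k)) (fun v => P.Psi w (P.Psi (e k) v))
    (fun v => P.Psi (e k) (P.Psi w v)) (fun i j => P.inner_Psi_Psi _ _ _ _)
  simp only [LinearMap.compl₂_apply, ContinuousLinearMap.coe_coe, map_neg] at h3
  have h5 : ∀ j, P.Q z (e k) (P.Psi w (P.Psi (e k) (e j))) (e j)
      = -P.Q z (e k) (e j) (P.Psi w (P.Psi (e k) (e j))) := fun j => P.Q_swap_right _ _ _ _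
  simp only [h5] at h4
  rw [Finset.sum_congr rfl fun j _ => h2 j, Finset.sum_add_distrib]
  simp only [P.Psi_swap _ w, map_neg, Finset.sum_neg_distrib] at h3 h4 ⊢
  linarith

/-- The vectors `n k m` are skew in k and m, so the sum of `ric_r_eq_sum` may be antisymmetrised and
fed into the Bianchi identity. Of the resulting terms, the one in Q and two of those quadratic in Ψ
vanish by J-type. The last gives the right side. -/
theorem ric_r (z w : V) :
    P.ric e z (r w) = ∑ i, inner ℝ (P.Psi z (e i)) (P.Psi w (r (e i))) := by
  rw [P.ric_r_eq_sum e hr]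
  let n : ι → ι → V := fun k m => P.Psi w (P.Psi (e k) (e m))
  have hn : ∀ k m, n k m = -n m k := fun k m => by
    simp only [n]; rw [P.Psi_swap (e k)]; simp
  have h1 : ∑ k, ∑ m, P.Q z (e k) (e m) (n k m) = -∑ k, ∑ m, P.Q z (e m) (e k) (n k m) := by
    rw [Finset.sum_comm, ← Finset.sum_neg_distrib]
    refine Finset.sum_congr rfl fun k _ => ?_
    rw [← Finset.sum_neg_distrib]
    refine Finset.sum_congr rfl fun m _ => ?_
    rw [hn, map_neg]
  have h2 : ∀ k m, P.Q z (e k) (e m) (n k m) - P.Q z (e m) (e k) (n k m) =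
      -P.Q z (n k m) (e k) (e m) - inner ℝ (P.Psi z (e k)) (P.Psi (e m) (n k m))
        - inner ℝ (P.Psi (e k) (e m)) (P.Psi z (n k m))
        - inner ℝ (P.Psi (e m) z) (P.Psi (e k) (n k m)) := fun k m => by
    have h := P.Q_bianchi z (e k) (e m) (n k m)
    rw [P.Q_swap_left (e m) z, P.Q_pair (e k)] at h
    linarith
  have hz : ∀ a k, ∑ m, inner ℝ a (P.Psi (e m) (P.Psi w (P.Psi (e k) (e m)))) = 0 := fun a k =>
    P.sum_apply_eq_zero e (LinearMap.mk₂ ℝ (fun u v => inner ℝ a (P.Psi u (P.Psi w v)))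
      (by simp [inner_add_right]) (by simp [inner_smul_right]) (by simp [inner_add_right])
      (by simp [inner_smul_right]))
      (fun u v => by simp [P.Psi_J, P.Psi_J_left, P.J_J]) (P.Psi (e k)) (P.Psi_J _)
  have h3 : ∑ k, ∑ m, inner ℝ (P.Psi z (e k)) (P.Psi (e m) (n k m)) = 0 :=
    Finset.sum_eq_zero fun k _ => hz _ _
  have h4 : ∑ k, ∑ m, inner ℝ (P.Psi (e m) z) (P.Psi (e k) (n k m)) = 0 := by
    rw [Finset.sum_comm]
    refine Finset.sum_eq_zero fun k _ => ?_
    simp only [hn _ k, map_neg, inner_neg_right, Finset.sum_neg_distrib, neg_eq_zero]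
    exact hz _ _
  -- Passing to the adjoint of Ψ_w Ψ_{e_k} leaves a contraction over k of the J-invariant form Q(z,
  -- e_m, ·, ·) with an operator anticommuting with J.
  have h5 : ∑ k, ∑ m, P.Q z (n k m) (e k) (e m) = 0 := by
    have h : ∀ k, ∑ m, P.Q z (n k m) (e k) (e m) =
        ∑ m, -P.Q z (e m) (e k) (P.Psi (P.Psi w (e m)) (e k)) := fun k => by
      have := sum_apply_adjoint e ((P.Q z).flip (e k)) (fun v => P.Psi w (P.Psi (e k) v))
        (fun v => P.Psi (e k) (P.Psi w v)) (fun i j => P.inner_Psi_Psi _ _ _ _)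
      simp only [LinearMap.flip_apply] at this
      rw [this]
      refine Finset.sum_congr rfl fun m _ => ?_
      rw [P.Psi_swap, map_neg]
    simp only [h]
    rw [Finset.sum_comm]
    refine Finset.sum_eq_zero fun m _ => ?_
    rw [Finset.sum_neg_distrib, neg_eq_zero]
    exact P.sum_apply_eq_zero e (P.Q z (e m)) (P.Q_J_J _ _) _ (P.Psi_J _)
  -- Moving Ψ_{e_k} to the other factor produces Ψ_{e_k}Ψ_{e_k}, which sums to -r.
  have h6 : ∑ k, ∑ m, inner ℝ (P.Psi (e k) (e m)) (P.Psi z (n k m)) =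
      -∑ i, inner ℝ (P.Psi z (e i)) (P.Psi w (r (e i))) := by
    have h : ∀ k, ∑ m, inner ℝ (P.Psi (e k) (e m)) (P.Psi z (n k m)) =
        ∑ m, inner ℝ (P.Psi z (e m)) (P.Psi w (P.Psi (e k) (P.Psi (e k) (e m)))) := fun k => by
      have := sum_apply_adjoint e ((innerₗ V).compl₁₂ (P.Psi z).toLinearMap
        ((P.Psi w).toLinearMap ∘ₗ (P.Psi (e k)).toLinearMap)) (P.Psi (e k))
        (fun v => -P.Psi (e k) v) (fun i j => by rw [P.inner_Psi, inner_neg_right])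
      simp only [LinearMap.compl₁₂_apply, LinearMap.comp_apply, ContinuousLinearMap.coe_coe,
        map_neg, innerₗ_apply_apply, Finset.sum_neg_distrib] at this
      rw [eq_neg_iff_add_eq_zero, add_comm, ← eq_neg_iff_add_eq_zero] at this
      rw [this, ← Finset.sum_neg_distrib]
      refine Finset.sum_congr rfl fun m _ => ?_
      rw [P.inner_Psi z, neg_neg]
    simp only [h]
    rw [Finset.sum_comm, ← Finset.sum_neg_distrib]
    refine Finset.sum_congr rfl fun m _ => ?_
    rw [← inner_sum, ← map_sum, P.sum_Psi_Psi e hr, map_neg, inner_neg_right]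
  have h7 : ∑ k, ∑ m, (P.Q z (e k) (e m) (n k m) - P.Q z (e m) (e k) (n k m)) = _ :=
    Finset.sum_congr rfl fun k _ => Finset.sum_congr rfl fun m _ => h2 k m
  simp only [Finset.sum_sub_distrib, Finset.sum_neg_distrib] at h7
  rw [h3, h4, h5, h6] at h7
  change 2 * ∑ k, ∑ m, P.Q z (e k) (e m) (n k m) = _
  linarith

/-- The right-hand side of `ric_r` is symmetric. -/
theorem sum_inner_Psi_r_comm (z w : V) :
    ∑ i, inner ℝ (P.Psi z (e i)) (P.Psi w (r (e i))) =
      ∑ i, inner ℝ (P.Psi w (e i)) (P.Psi z (r (e i))) := by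
  have hsymm : ∀ u v, inner ℝ (r u) v = inner ℝ u (r v) := fun u v => by
    rw [real_inner_comm (r v) u, hr, hr]
    exact Finset.sum_congr rfl fun i _ => real_inner_comm _ _
  have h := sum_apply_adjoint e ((innerₗ V).compl₁₂ (P.Psi z).toLinearMap (P.Psi w).toLinearMap)
    r r (fun i j => hsymm _ _)
  simp only [LinearMap.compl₁₂_apply, ContinuousLinearMap.coe_coe, innerₗ_apply_apply] at h
  rw [← h]
  exact Finset.sum_congr rfl fun i _ => real_inner_comm _ _

/-- Distinct eigenspaces of `r` are orthogonal for the Ricci form of the canonical connection. -/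
theorem ric_eq_zero {c d : ℝ} (hcd : c ≠ d) {u v : V} (hu : r u = c • u) (hv : r v = d • v) :
    P.ric e u v = 0 := by
  have h1 := P.ric_r e hr u v
  have h2 := P.ric_r e hr v u
  -- By symmetry of the right side of `ric_r`, r is self-adjoint for ric; on eigenvectors this reads
  -- (c - d) ric(u, v) = 0.
  rw [P.sum_inner_Psi_r_comm e hr, ← h1, P.ric_comm, hu, hv] at h2
  have h3 : ∀ (t : ℝ) (a b : V), P.ric e a (t • b) = t * P.ric e a b := fun t a b => by
    simp [ric, Finset.mul_sum]
  rw [P.ric_comm e _ v, h3, h3] at h2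
  rw [P.ric_comm e v u] at h2
  have : (c - d) * P.ric e u v = 0 := by linarith
  exact (mul_eq_zero.mp this).resolve_left (sub_ne_zero.mpr hcd)

theorem ric_of_eigenvector {c : ℝ} (hc : c ≠ 0) {u v : V} (hv : r v = c • v) :
    P.ric e u v = 1 / c * ∑ i, inner ℝ (P.Psi u (e i)) (P.Psi v (r (e i))) := by
  rw [← P.ric_r e hr, hv]
  have h3 : P.ric e u (c • v) = c * P.ric e u v := by
    simp [ric, Finset.mul_sum]
  rw [h3]; field_simp

end PointModel
end NearlyKahler

/-! ### Global smooth vector fields and local orthonormal frames -/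

namespace NearlyKahler

open Filter Topology

variable {E : Type*} [NormedAddCommGroup E] [NormedSpace ℝ E] [FiniteDimensional ℝ E]
  {M : Type*} [TopologicalSpace M] [ChartedSpace E M] [IsManifold 𝓘(ℝ, E) ∞ M]

variable (E M) in
/-- The smooth vector fields on `M`. -/
abbrev VF := Cₛ^∞⟮𝓘(ℝ, E); E, fun x : M => TangentSpace 𝓘(ℝ, E) x⟯

variable (E M) in
/-- The smooth functions on `M`. -/
abbrev SF := C^∞⟮𝓘(ℝ, E), M; 𝓘(ℝ, ℝ), ℝ⟯

/-- A bump function cuts the local section off without changing its germ at x, so derivatives at x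
may be computed with global fields. -/
theorem exists_vectorField_eventuallyEq [T2Space M] {x : M} {U : Set M} (hU : U ∈ 𝓝 x)
    {s : Π y : M, TangentSpace 𝓘(ℝ, E) y} (hs : CMDiff[U] ∞ (T% s)) :
    ∃ X : VF E M, ⇑X =ᶠ[𝓝 x] s := by
  obtain ⟨f, -, hf⟩ := (SmoothBumpFunction.nhds_basis_tsupport (I := 𝓘(ℝ, E)) x).mem_iff.mp
    (interior_mem_nhds.mpr hU)
  refine ⟨⟨(f : M → ℝ) • s, ContMDiffOn.smul_section_of_tsupport f.contMDiff.contMDiffOn isOpen_interior hf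
    (hs.mono interior_subset)⟩, ?_⟩
  filter_upwards [f.eventuallyEq_one] with y hy
  change f y • s y = s y
  rw [hy, Pi.one_apply, one_smul]

theorem exists_vectorField_extend [T2Space M] {x : M} (v : TangentSpace 𝓘(ℝ, E) x) :
    ∃ X : VF E M, ⇑X =ᶠ[𝓝 x] (extend E v : Π y : M, TangentSpace 𝓘(ℝ, E) y) := by
  obtain ⟨U, hU, hs⟩ := exists_contMDiffOn_extend (k := ∞) 𝓘(ℝ, E) E v
  exact exists_vectorField_eventuallyEq hU hs

theorem exists_vectorField_apply_eq [T2Space M] {x : M} (v : TangentSpace 𝓘(ℝ, E) x) :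
    ∃ X : VF E M, X x = v := by
  obtain ⟨X, hX⟩ := exists_vectorField_extend v
  exact ⟨X, by rw [hX.eq_of_nhds, extend_apply_self]⟩

variable [RiemannianBundle (fun x : M => TangentSpace 𝓘(ℝ, E) x)]
  [IsContMDiffRiemannianBundle 𝓘(ℝ, E) ∞ E (fun x : M => TangentSpace 𝓘(ℝ, E) x)]

omit [FiniteDimensional ℝ E] in
theorem contMDiffOn_inner {U : Set M} {X Y : Π y : M, TangentSpace 𝓘(ℝ, E) y}
    (hX : CMDiff[U] ∞ (T% X)) (hY : CMDiff[U] ∞ (T% Y)) :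
    CMDiff[U] ∞ (fun y => inner ℝ (X y) (Y y)) :=
  ContMDiffOn.inner_bundle (IB := 𝓘(ℝ, E)) (F := E) (E := fun y : M => TangentSpace 𝓘(ℝ, E) y)
    (b := fun y => y) hX hY

omit [FiniteDimensional ℝ E] in
theorem contMDiffOn_gramSchmidt {n : ℕ} {U : Set M}
    {s : Fin n → Π y : M, TangentSpace 𝓘(ℝ, E) y} (hs : ∀ i, CMDiff[U] ∞ (T% (s i)))
    (hli : ∀ y ∈ U, LinearIndependent ℝ (s · y)) (i : Fin n) :
    CMDiff[U] ∞ (T% (fun y => InnerProductSpace.gramSchmidt ℝ (s · y) i)) := by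
  induction i using WellFoundedLT.induction with
  | ind i ih =>
    have h0 : ∀ j, ∀ y ∈ U, InnerProductSpace.gramSchmidt ℝ (s · y) j ≠ 0 := fun j y hy =>
      InnerProductSpace.gramSchmidt_ne_zero j (hli y hy)
    have h1 : CMDiff[U] ∞ (T% (fun y => ∑ j ∈ Finset.Iio i,
        (inner ℝ (InnerProductSpace.gramSchmidt ℝ (s · y) j) (s i y)
          / inner ℝ (InnerProductSpace.gramSchmidt ℝ (s · y) j)
            (InnerProductSpace.gramSchmidt ℝ (s · y) j))
          • InnerProductSpace.gramSchmidt ℝ (s · y) j)) := by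
      refine ContMDiffOn.sum_section fun j hj => ?_
      have hj := ih j (Finset.mem_Iio.mp hj)
      refine ContMDiffOn.smul_section (ContMDiffOn.div₀ (contMDiffOn_inner hj (hs i))
        (contMDiffOn_inner hj hj) fun y hy => ?_) hj
      exact inner_self_ne_zero.mpr (h0 j y hy)
    refine ((hs i).sub_section h1).congr fun y hy => ?_
    rw [TotalSpace.mk_inj, Pi.sub_apply, eq_sub_iff_add_eq]
    conv_rhs => rw [InnerProductSpace.gramSchmidt_def'' ℝ (s · y) i]
    simp

theorem exists_orthonormal_vectorFields [T2Space M] (x : M) :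
    ∃ e : Fin (Module.finrank ℝ E) → VF E M, ∀ᶠ y in 𝓝 x, Orthonormal ℝ (fun i => e i y) := by
  let t := trivializationAt E (fun y : M => TangentSpace 𝓘(ℝ, E) y) x
  let b := Module.finBasis ℝ E
  have hf := t.isLocalFrameOn_localFrame_baseSet 𝓘(ℝ, E) ∞ b
  have hU : t.baseSet ∈ 𝓝 x := t.open_baseSet.mem_nhds (mem_baseSet_trivializationAt' x)
  have hg := contMDiffOn_gramSchmidt hf.contMDiffOn (fun y hy => hf.linearIndependent hy)
  have hn : ∀ i, CMDiff[t.baseSet] ∞ (T% (fun y =>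
      InnerProductSpace.gramSchmidtNormed ℝ (t.localFrame b · y) i)) := by
    intro i
    refine ContMDiffOn.smul_section (f := fun y =>
      (‖InnerProductSpace.gramSchmidt ℝ (t.localFrame b · y) i‖⁻¹ : ℝ)) ?_ (hg i)
    have h0 : ∀ y ∈ t.baseSet, InnerProductSpace.gramSchmidt ℝ (t.localFrame b · y) i ≠ 0 :=
      fun y hy => InnerProductSpace.gramSchmidt_ne_zero i (hf.linearIndependent hy)
    refine ContMDiffOn.inv₀ (fun y hy => ?_) fun y hy => norm_ne_zero_iff.mpr (h0 y hy)
    simp only [norm_eq_sqrt_real_inner]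
    exact (Real.contDiffAt_sqrt (inner_self_ne_zero.mpr (h0 y hy))).contMDiffAt.comp_contMDiffWithinAt
      y (contMDiffOn_inner (hg i) (hg i) y hy)
  choose e he using fun i => exists_vectorField_eventuallyEq hU (hn i)
  refine ⟨e, ?_⟩
  filter_upwards [eventually_all.mpr he, hU] with y hy hyU
  simp only [hy]
  exact InnerProductSpace.gramSchmidtNormed_orthonormal (hf.linearIndependent hyU)

/-- An orthonormal family of the right size, as an orthonormal basis of the tangent space. -/
noncomputable def frameBasis {x : M} {e : Fin (Module.finrank ℝ E) → TangentSpace 𝓘(ℝ, E) x}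
    (he : Orthonormal ℝ e) :
    OrthonormalBasis (Fin (Module.finrank ℝ E)) ℝ (TangentSpace 𝓘(ℝ, E) x) :=
  OrthonormalBasis.mk he (by
    have h : Module.finrank ℝ (TangentSpace 𝓘(ℝ, E) x) = Module.finrank ℝ E := rfl
    rw [he.linearIndependent.span_eq_top_of_card_eq_finrank' (by simp [h])])

omit [IsManifold 𝓘(ℝ, E) ∞ M]
  [IsContMDiffRiemannianBundle 𝓘(ℝ, E) ∞ E fun x : M => TangentSpace 𝓘(ℝ, E) x] in
@[simp] theorem frameBasis_apply {x : M} {e : Fin (Module.finrank ℝ E) → TangentSpace 𝓘(ℝ, E) x}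
    (he : Orthonormal ℝ e) (i) : frameBasis he i = e i := by simp [frameBasis]

/-- A vector field is smooth as soon as its inner products with the smooth vector fields are. -/
theorem contMDiff_of_inner [T2Space M] {s : Π y : M, TangentSpace 𝓘(ℝ, E) y}
    (h : ∀ Z : VF E M, CMDiff ∞ (fun y => inner ℝ (s y) (Z y))) : CMDiff ∞ (T% s) := by
  intro x
  obtain ⟨e, he⟩ := exists_orthonormal_vectorFields (E := E) x
  have h1 : CMDiffAt ∞ (T% (fun y => ∑ i, (inner ℝ (s y) (e i y)) • e i y)) x :=
    ContMDiffAt.sum_section fun i _ => (h (e i) x).smul_section ((e i).contMDiff x)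
  refine h1.congr_of_eventuallyEq ?_
  filter_upwards [he] with y hy
  have := (frameBasis hy).sum_repr' (s y)
  simp only [frameBasis_apply, real_inner_comm] at this
  rw [TotalSpace.mk_inj, this]

end NearlyKahler

/-! ### The manifold as an instance of the algebraic calculus -/

namespace NearlyKahler

open Filter Topology

variable {E : Type*} [NormedAddCommGroup E] [NormedSpace ℝ E] [FiniteDimensional ℝ E]
  {M : Type*} [TopologicalSpace M] [ChartedSpace E M] [IsManifold 𝓘(ℝ, E) ∞ M]

omit [FiniteDimensional ℝ E] in
theorem contMDiff_mvfderiv_apply {f : M → ℝ} {X : Π y : M, TangentSpace 𝓘(ℝ, E) y}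
    (hf : CMDiff ∞ f) (hX : CMDiff ∞ (T% X)) : CMDiff ∞ (fun y => d% f y (X y)) := by
  have h := (hf.contMDiff_tangentMap (m := ∞) (by simp)).comp hX
  exact (contMDiff_snd_tangentBundle_modelSpace ℝ 𝓘(ℝ, ℝ)).comp h

theorem contMDiff_mlieBracket {X Y : Π y : M, TangentSpace 𝓘(ℝ, E) y}
    (hX : CMDiff ∞ (T% X)) (hY : CMDiff ∞ (T% Y)) :
    CMDiff ∞ (T% (mlieBracket 𝓘(ℝ, E) X Y)) := by
  have := FiniteDimensional.complete ℝ E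
  have : IsManifold 𝓘(ℝ, E) (minSmoothness ℝ 2) M := by
    rw [minSmoothness_of_isRCLikeNormedField]; infer_instance
  have : IsManifold 𝓘(ℝ, E) (((⊤ : ℕ∞) : ℕ∞ω) + 1) M := by simpa using! ‹IsManifold 𝓘(ℝ, E) ∞ M›
  exact ContDiff.mlieBracket_vectorField (m := ⊤) (n := ⊤) hX hY (by simp)

namespace VF

omit [FiniteDimensional ℝ E] in
theorem mdiffAt (X : VF E M) (x : M) : MDiffAt (T% (fun y => X y)) x := X.mdifferentiableAt

omit [FiniteDimensional ℝ E] [IsManifold 𝓘(ℝ, E) ∞ M] in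
theorem _root_.NearlyKahler.SF.mdiffAt (f : SF E M) (x : M) : MDiffAt (f : M → ℝ) x :=
  f.contMDiff.mdifferentiable (by simp) x

/-- The derivative of functions along a vector field. -/
noncomputable def deriv (X : VF E M) : SF E M →ₗ[ℝ] SF E M where
  toFun f := ⟨fun y => d% (f : M → ℝ) y (X y), contMDiff_mvfderiv_apply f.contMDiff X.contMDiff⟩
  map_add' f g := by
    ext y
    change d% ((f : M → ℝ) + (g : M → ℝ)) y (X y) = _
    rw [mvfderiv_add (SF.mdiffAt f y) (SF.mdiffAt g y)]; rfl
  map_smul' c f := by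
    ext y
    have h := mvfderiv_mul (f := fun _ : M => c) (g := (f : M → ℝ))
      (I := 𝓘(ℝ, E)) (mdifferentiableAt_const (x := y)) (SF.mdiffAt f y)
    rw [mvfderiv_const, smul_zero, add_zero] at h
    exact congr($h (X y))

/-- The Lie bracket of smooth vector fields. -/
noncomputable def bracket (X Y : VF E M) : VF E M :=
  ⟨mlieBracket 𝓘(ℝ, E) X Y, contMDiff_mlieBracket X.contMDiff Y.contMDiff⟩

theorem bracket_jacobi (X Y Z : VF E M) :
    bracket X (bracket Y Z) = bracket (bracket X Y) Z + bracket Y (bracket X Z) := by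
  have := FiniteDimensional.complete ℝ E
  have : IsManifold 𝓘(ℝ, E) (minSmoothness ℝ 3) M := by
    rw [minSmoothness_of_isRCLikeNormedField]; infer_instance
  have hs : ∀ X : VF E M, CMDiff (minSmoothness ℝ 2) (T% (fun y => X y)) := fun X => by
    rw [minSmoothness_of_isRCLikeNormedField]
    exact X.contMDiff.of_le ENat.LEInfty.out
  ext x : 1
  exact congrFun (leibniz_identity_mlieBracket (hs X) (hs Y) (hs Z)) x

/-- The product of a function and a vector field. -/
noncomputable def fsmul (f : SF E M) (X : VF E M) : VF E M :=
  ⟨(f : M → ℝ) • (fun y => X y), f.contMDiff.smul_section X.contMDiff⟩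

theorem bracket_fsmul (f : SF E M) (X Y : VF E M) :
    bracket X (fsmul f Y) = fsmul (deriv X f) Y + fsmul f (bracket X Y) := by
  have := FiniteDimensional.complete ℝ E
  ext x : 1
  exact mlieBracket_smul_right (SF.mdiffAt f x) (mdiffAt Y x)

theorem bracket_add (X Y Z : VF E M) : bracket X (Y + Z) = bracket X Y + bracket X Z := by
  have := FiniteDimensional.complete ℝ E
  ext x : 1
  exact mlieBracket_add_right (mdiffAt Y x) (mdiffAt Z x)

/-- Apply the Jacobi identity to X, Y and fZ with Z x ≠ 0: the coefficient of Z x is the claim. If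
the tangent space at x is zero, every derivative there vanishes. -/
theorem deriv_bracket [T2Space M] (X Y : VF E M) (f : SF E M) :
    deriv (bracket X Y) f = deriv X (deriv Y f) - deriv Y (deriv X f) := by
  ext x
  by_cases hx : ∃ v : TangentSpace 𝓘(ℝ, E) x, v ≠ 0
  · obtain ⟨v, hv⟩ := hx
    obtain ⟨Z, hZ⟩ := exists_vectorField_apply_eq v
    have h := bracket_jacobi X Y (fsmul f Z)
    simp only [bracket_fsmul, bracket_add, bracket_jacobi X Y Z] at h
    have h' := congrArg (fun W : VF E M => W x) h
    change deriv X (deriv Y f) x • Z x + deriv Y f x • bracket X Z x +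
      (deriv X f x • bracket Y Z x + f x • (bracket (bracket X Y) Z x + bracket Y (bracket X Z) x))
      = deriv (bracket X Y) f x • Z x + f x • bracket (bracket X Y) Z x +
        (deriv Y (deriv X f) x • Z x + deriv X f x • bracket Y Z x
          + (deriv Y f x • bracket X Z x + f x • bracket Y (bracket X Z) x)) at h'
    have h2 : (deriv (bracket X Y) f x - (deriv X (deriv Y f) x - deriv Y (deriv X f) x)) • v = 0 := by
      rw [← hZ]
      linear_combination (norm := module) -h'
    exact sub_eq_zero.mp ((smul_eq_zero.mp h2).resolve_right hv)
  · push Not at hx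
    have h0 : ∀ (W : VF E M) (g : SF E M), deriv W g x = 0 := fun W g => by
      change d% (g : M → ℝ) x (W x) = 0
      rw [hx (W x), map_zero]
    change deriv _ _ x = deriv X (deriv Y f) x - deriv Y (deriv X f) x
    simp [h0]

variable [RiemannianBundle (fun x : M => TangentSpace 𝓘(ℝ, E) x)]
  [IsContMDiffRiemannianBundle 𝓘(ℝ, E) ∞ E (fun x : M => TangentSpace 𝓘(ℝ, E) x)]

/-- The metric, as a form on smooth vector fields. -/
noncomputable def metric : VF E M →ₗ[ℝ] VF E M →ₗ[ℝ] SF E M :=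
  LinearMap.mk₂ ℝ (fun X Y => ⟨fun y => inner ℝ (X y) (Y y),
      contMDiffOn_univ.mp (contMDiffOn_inner X.contMDiff.contMDiffOn Y.contMDiff.contMDiffOn)⟩)
    (fun X Y Z => by ext y; exact inner_add_left (X y) (Y y) (Z y))
    (fun c X Y => by ext y; exact real_inner_smul_left (X y) (Y y) c)
    (fun X Y Z => by ext y; exact inner_add_right (X y) (Y y) (Z y))
    (fun c X Y => by ext y; exact real_inner_smul_right (X y) (Y y) c)

omit [FiniteDimensional ℝ E] in
theorem metric_apply (X Y : VF E M) (x : M) : metric X Y x = inner ℝ (X x) (Y x) := rfl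

/-- Against each smooth Z the inner product is the Koszul expression, which is smooth. -/
theorem contMDiff_leviCivita [T2Space M] (X Y : VF E M) :
    CMDiff ∞ (T% (fun y => leviCivita 𝓘(ℝ, E) M Y y (X y))) := by
  refine contMDiff_of_inner fun Z => ?_
  have h : (fun y => inner ℝ (leviCivita 𝓘(ℝ, E) M Y y (X y)) (Z y)) =
      ((1 / 2 : ℝ) • (deriv X (metric Y Z) + deriv Y (metric Z X) - deriv Z (metric X Y)
        + metric (bracket X Y) Z - metric (bracket Y Z) X + metric (bracket Z X) Y) : SF E M) := by
    ext y
    exact inner_leviCivita 𝓘(ℝ, E) (mdiffAt X y) (mdiffAt Y y) (mdiffAt Z y)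
  rw [h]
  exact ContMDiffMap.contMDiff _

/-- The Levi-Civita connection on smooth vector fields. -/
noncomputable def nabla [T2Space M] : VF E M →ₗ[ℝ] VF E M →ₗ[ℝ] VF E M :=
  LinearMap.mk₂ ℝ (fun X Y => ⟨fun y => leviCivita 𝓘(ℝ, E) M Y y (X y), contMDiff_leviCivita X Y⟩)
    (fun X Y Z => by ext y : 1; exact map_add (leviCivita 𝓘(ℝ, E) M Z y) (X y) (Y y))
    (fun c X Y => by ext y : 1; exact map_smul (leviCivita 𝓘(ℝ, E) M Y y) c (X y))
    (fun X Y Z => by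
      ext y : 1
      exact congr($((leviCivita 𝓘(ℝ, E) M).isCovariantDerivativeOnUniv.add
        (mdiffAt Y y) (mdiffAt Z y)) (X y)))
    (fun c X Y => by
      ext y : 1
      exact congr($((leviCivita 𝓘(ℝ, E) M).isCovariantDerivativeOnUniv.smul_const c
        (mdiffAt Y y)) (X y)))

theorem nabla_sub_nabla [T2Space M] (X Y : VF E M) : nabla X Y - nabla Y X = bracket X Y := by
  have := FiniteDimensional.complete ℝ E
  ext x : 1
  exact (CovariantDerivative.torsion_eq_zero_iff _).mp (leviCivita_torsion 𝓘(ℝ, E))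
    (mdiffAt X x) (mdiffAt Y x)

theorem ext_metric [T2Space M] {X Y : VF E M} (h : ∀ Z, metric X Z = metric Y Z) : X = Y := by
  ext x : 1
  refine ext_inner_right ℝ fun v => ?_
  obtain ⟨Z, rfl⟩ := exists_vectorField_apply_eq v
  exact congrArg (fun f : SF E M => f x) (h Z)

end VF

namespace AlmostHermitian

variable [RiemannianBundle (fun x : M => TangentSpace 𝓘(ℝ, E) x)]
  [IsContMDiffRiemannianBundle 𝓘(ℝ, E) ∞ E (fun x : M => TangentSpace 𝓘(ℝ, E) x)]
  (𝒥 : AlmostHermitian 𝓘(ℝ, E) M)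

/-- The almost complex structure on smooth vector fields. -/
noncomputable def JVF : VF E M →ₗ[ℝ] VF E M where
  toFun X := ⟨fun y => 𝒥.J y (X y), ContMDiff.clm_bundle_apply (F₁ := E)
    (E₁ := fun y : M => TangentSpace 𝓘(ℝ, E) y) (F₂ := E)
    (E₂ := fun y : M => TangentSpace 𝓘(ℝ, E) y) (b := fun y => y) 𝒥.contMDiff X.contMDiff⟩
  map_add' X Y := by ext y : 1; exact map_add (𝒥.J y) (X y) (Y y)
  map_smul' c X := by ext y : 1; exact map_smul (𝒥.J y) c (X y)

theorem nablaJ_vectorField [T2Space M] (X Y : VF E M) (x : M) :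
    𝒥.nablaJ x (X x) (Y x) = (VF.nabla X (𝒥.JVF Y) - 𝒥.JVF (VF.nabla X Y)) x :=
  𝒥.nablaJ_apply (VF.mdiffAt Y x) (X x)

/-- The calculus of smooth vector fields on a nearly Kähler manifold. -/
noncomputable def calculus [T2Space M] (h : 𝒥.IsNearlyKahler) : Calculus (VF E M) (SF E M) where
  D := VF.deriv
  g := VF.metric
  nabla := VF.nabla
  J := 𝒥.JVF
  g_comm X Y := by ext x; exact real_inner_comm (Y x) (X x)
  ext_g X Y := VF.ext_metric
  D_g X Y Z := by
    ext x
    exact leviCivita_metric 𝓘(ℝ, E) (VF.mdiffAt X x) (VF.mdiffAt Y x) (VF.mdiffAt Z x)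
  J_J X := by ext x : 1; exact 𝒥.sq x (X x)
  g_J_J X Y := by ext x; exact 𝒥.inner_map x (X x) (Y x)
  nabla_J_self X := by
    ext x : 1
    have := 𝒥.nablaJ_vectorField X X x
    rw [h] at this
    exact sub_eq_zero.mp this.symm
  D_bracket X Y f := by rw [VF.nabla_sub_nabla, VF.deriv_bracket]
  jacobi X Y Z := by simp only [VF.nabla_sub_nabla]; exact VF.bracket_jacobi X Y Z

theorem calculus_Psi_apply [T2Space M] (h : 𝒥.IsNearlyKahler) (X Y : VF E M) (x : M) :
    (𝒥.calculus h).Psi X Y x = 𝒥.nablaJ x (X x) (Y x) :=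
  (𝒥.nablaJ_vectorField X Y x).symm

end AlmostHermitian

end NearlyKahler

/-! ### From curvature of vector fields to curvature at a point -/

namespace NearlyKahler

open Filter Topology

variable {E : Type*} [NormedAddCommGroup E] [NormedSpace ℝ E] [FiniteDimensional ℝ E]
  {M : Type*} [TopologicalSpace M] [ChartedSpace E M] [IsManifold 𝓘(ℝ, E) ∞ M]
  [RiemannianBundle (fun x : M => TangentSpace 𝓘(ℝ, E) x)]
  [IsContMDiffRiemannianBundle 𝓘(ℝ, E) ∞ E (fun x : M => TangentSpace 𝓘(ℝ, E) x)]

theorem leviCivita_congr {X : VF E M} {Y : Π y : M, TangentSpace 𝓘(ℝ, E) y} {x : M}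
    (h : ⇑X =ᶠ[𝓝 x] Y) : leviCivita 𝓘(ℝ, E) M X x = leviCivita 𝓘(ℝ, E) M Y x := by
  refine (leviCivita 𝓘(ℝ, E) M).isCovariantDerivativeOnUniv.congr_of_eventuallyEq
    (VF.mdiffAt X x) ((VF.mdiffAt X x).congr_of_eventuallyEq ?_) univ_mem h
  filter_upwards [h] with y hy
  rw [hy]

theorem leviCivita_apply_congr {X Y : VF E M} {X' Y' : Π y : M, TangentSpace 𝓘(ℝ, E) y} {x : M}
    (hX : ⇑X =ᶠ[𝓝 x] X') (hY : ⇑Y =ᶠ[𝓝 x] Y') :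
    (fun y => leviCivita 𝓘(ℝ, E) M Y y (X y)) =ᶠ[𝓝 x]
      fun y => leviCivita 𝓘(ℝ, E) M Y' y (X' y) := by
  filter_upwards [hX, hY.eventuallyEq_nhds] with y hXy hYy
  rw [leviCivita_congr hYy, hXy]

namespace AlmostHermitian

variable [T2Space M] (𝒥 : AlmostHermitian 𝓘(ℝ, E) M) (h : 𝒥.IsNearlyKahler)

/-- Dependence on the last slot is pointwise by definition, and the symmetries of R carry this to
the other slots; no Leibniz rule is needed. -/
theorem Rm_congr {X Y Z W X' Y' Z' W' : VF E M} {x : M} (hX : X x = X' x) (hY : Y x = Y' x)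
    (hZ : Z x = Z' x) (hW : W x = W' x) :
    (𝒥.calculus h).Rm X Y Z W x = (𝒥.calculus h).Rm X' Y' Z' W' x := by
  have h4 : ∀ X Y Z W W' : VF E M, W x = W' x →
      (𝒥.calculus h).Rm X Y Z W x = (𝒥.calculus h).Rm X Y Z W' x := fun X Y Z W W' hW => by
    change -inner ℝ ((𝒥.calculus h).R X Y Z x) (W x) = -inner ℝ ((𝒥.calculus h).R X Y Z x) (W' x)
    rw [hW]
  have h3 : ∀ X Y Z W Z' : VF E M, Z x = Z' x →
      (𝒥.calculus h).Rm X Y Z W x = (𝒥.calculus h).Rm X Y Z' W x := fun X Y Z W Z' hZ => by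
    rw [Calculus.Rm_swap_right, (𝒥.calculus h).Rm_swap_right X Y Z']
    exact congrArg Neg.neg (h4 _ _ _ _ _ hZ)
  rw [h4 X Y Z W W' hW, h3 X Y Z W' Z' hZ, Calculus.Rm_pair, h4 _ _ _ _ _ hY, h3 _ _ _ _ _ hX,
    Calculus.Rm_pair]

/-- The extensions in `curvature` are smooth only near x. They are replaced by global fields with
the same germs, and `Rm_congr` passes from these to the given fields. -/
theorem curvature_eq_Rm (X Y Z W : VF E M) (x : M) :
    curvature 𝓘(ℝ, E) x (X x) (Y x) (Z x) (W x) = (𝒥.calculus h).Rm X Y Z W x := by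
  obtain ⟨X', hX⟩ := exists_vectorField_extend (X x)
  obtain ⟨Y', hY⟩ := exists_vectorField_extend (Y x)
  obtain ⟨Z', hZ⟩ := exists_vectorField_extend (Z x)
  have eX : X x = X' x := by rw [hX.eq_of_nhds, extend_apply_self]
  have eY : Y x = Y' x := by rw [hY.eq_of_nhds, extend_apply_self]
  have eZ : Z x = Z' x := by rw [hZ.eq_of_nhds, extend_apply_self]
  rw [𝒥.Rm_congr h eX eY eZ rfl]
  change _ = -inner ℝ ((𝒥.calculus h).R X' Y' Z' x) (W x)
  rw [curvature]
  congr 2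
  have e1 := leviCivita_congr (X := VF.nabla Y' Z') (leviCivita_apply_congr hY hZ)
  have e2 := leviCivita_congr (X := VF.nabla X' Z') (leviCivita_apply_congr hX hZ)
  have e3 := leviCivita_congr hZ
  have e4 := EventuallyEq.mlieBracket_vectorField_eq (I := 𝓘(ℝ, E)) hX hY
  have e5 : (𝒥.calculus h).R X' Y' Z' = VF.nabla X' (VF.nabla Y' Z') - VF.nabla Y' (VF.nabla X' Z')
      - VF.nabla (VF.bracket X' Y') Z' := by
    rw [← VF.nabla_sub_nabla]; rfl
  rw [e5, curvatureField, ← e1, ← e2, ← e3, ← e4, ← hX.eq_of_nhds, ← hY.eq_of_nhds]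
  rfl

end AlmostHermitian
end NearlyKahler

/-! ### The pointwise curvature identities and the Ricci tensors -/

namespace NearlyKahler

namespace AlmostHermitian

variable {E : Type*} [NormedAddCommGroup E] [NormedSpace ℝ E] [FiniteDimensional ℝ E]
  {M : Type*} [TopologicalSpace M] [T2Space M] [ChartedSpace E M] [IsManifold 𝓘(ℝ, E) ∞ M]
  [RiemannianBundle (fun x : M => TangentSpace 𝓘(ℝ, E) x)]
  [IsContMDiffRiemannianBundle 𝓘(ℝ, E) ∞ E (fun x : M => TangentSpace 𝓘(ℝ, E) x)]
  (𝒥 : AlmostHermitian 𝓘(ℝ, E) M) (h : 𝒥.IsNearlyKahler) {x : M}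

section Tensors

variable (a b c d f : TangentSpace 𝓘(ℝ, E) x)
include h

omit [T2Space M] in
theorem nablaJ_swap : 𝒥.nablaJ x a b = -𝒥.nablaJ x b a := by
  have h' := h x (a + b)
  simp only [map_add, add_apply, h x, zero_add, add_zero] at h'
  exact eq_neg_of_add_eq_zero_right h'

theorem nablaJ_J : 𝒥.nablaJ x a (𝒥.J x b) = -𝒥.J x (𝒥.nablaJ x a b) := by
  obtain ⟨A, rfl⟩ := exists_vectorField_apply_eq a
  obtain ⟨B, rfl⟩ := exists_vectorField_apply_eq b
  have := congrArg (fun X : VF E M => X x) ((𝒥.calculus h).Psi_J A B)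
  rw [← 𝒥.calculus_Psi_apply h A B]
  exact (𝒥.calculus_Psi_apply h A (𝒥.JVF B) x).symm.trans this

theorem inner_nablaJ : inner ℝ (𝒥.nablaJ x a b) c = -inner ℝ b (𝒥.nablaJ x a c) := by
  obtain ⟨A, rfl⟩ := exists_vectorField_apply_eq a
  obtain ⟨B, rfl⟩ := exists_vectorField_apply_eq b
  obtain ⟨C, rfl⟩ := exists_vectorField_apply_eq c
  rw [← 𝒥.calculus_Psi_apply h A B, ← 𝒥.calculus_Psi_apply h A C]
  exact congrArg (fun f : SF E M => f x) ((𝒥.calculus h).g_Psi A B C)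

theorem curvature_swap_left :
    curvature 𝓘(ℝ, E) x a b c d = -curvature 𝓘(ℝ, E) x b a c d := by
  obtain ⟨A, rfl⟩ := exists_vectorField_apply_eq a
  obtain ⟨B, rfl⟩ := exists_vectorField_apply_eq b
  obtain ⟨C, rfl⟩ := exists_vectorField_apply_eq c
  obtain ⟨D, rfl⟩ := exists_vectorField_apply_eq d
  simp only [𝒥.curvature_eq_Rm h]
  exact congrArg (fun f : SF E M => f x) ((𝒥.calculus h).Rm_swap_left A B C D)

theorem curvature_pair :
    curvature 𝓘(ℝ, E) x a b c d = curvature 𝓘(ℝ, E) x c d a b := by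
  obtain ⟨A, rfl⟩ := exists_vectorField_apply_eq a
  obtain ⟨B, rfl⟩ := exists_vectorField_apply_eq b
  obtain ⟨C, rfl⟩ := exists_vectorField_apply_eq c
  obtain ⟨D, rfl⟩ := exists_vectorField_apply_eq d
  simp only [𝒥.curvature_eq_Rm h]
  exact congrArg (fun f : SF E M => f x) ((𝒥.calculus h).Rm_pair A B C D)

theorem curvature_bianchi :
    curvature 𝓘(ℝ, E) x a b c d + curvature 𝓘(ℝ, E) x b c a d + curvature 𝓘(ℝ, E) x c a b d = 0 := by
  obtain ⟨A, rfl⟩ := exists_vectorField_apply_eq a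
  obtain ⟨B, rfl⟩ := exists_vectorField_apply_eq b
  obtain ⟨C, rfl⟩ := exists_vectorField_apply_eq c
  obtain ⟨D, rfl⟩ := exists_vectorField_apply_eq d
  simp only [𝒥.curvature_eq_Rm h]
  exact congrArg (fun f : SF E M => f x) ((𝒥.calculus h).Rm_bianchi A B C D)

theorem curvature_sub_curvature_J :
    curvature 𝓘(ℝ, E) x a b c d - curvature 𝓘(ℝ, E) x a b (𝒥.J x c) (𝒥.J x d) =
      inner ℝ (𝒥.nablaJ x a b) (𝒥.nablaJ x c d) := by
  obtain ⟨A, rfl⟩ := exists_vectorField_apply_eq a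
  obtain ⟨B, rfl⟩ := exists_vectorField_apply_eq b
  obtain ⟨C, rfl⟩ := exists_vectorField_apply_eq c
  obtain ⟨D, rfl⟩ := exists_vectorField_apply_eq d
  rw [← 𝒥.calculus_Psi_apply h A B, ← 𝒥.calculus_Psi_apply h C D, 𝒥.curvature_eq_Rm h]
  change _ - curvature 𝓘(ℝ, E) x (A x) (B x) (𝒥.JVF C x) (𝒥.JVF D x) = _
  rw [𝒥.curvature_eq_Rm h]
  exact congrArg (fun f : SF E M => f x) ((𝒥.calculus h).Rm_sub_Rm_J A B C D)

end Tensors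

/-- The curvature form of the canonical Hermitian connection. -/
noncomputable def hermitianCurvature (a b c d : TangentSpace 𝓘(ℝ, E) x) : ℝ :=
  curvature 𝓘(ℝ, E) x a b c d
    - 1 / 2 * inner ℝ (𝒥.nablaJ x a b) (𝒥.nablaJ x c d)
    + 1 / 4 * (inner ℝ (𝒥.nablaJ x a c) (𝒥.nablaJ x b d)
      - inner ℝ (𝒥.nablaJ x b c) (𝒥.nablaJ x a d))

theorem hermitianCurvature_eq_Qm (A B C D : VF E M) (x : M) :
    𝒥.hermitianCurvature (A x) (B x) (C x) (D x) = (𝒥.calculus h).Qm A B C D x := by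
  rw [Calculus.Qm_eq, hermitianCurvature, 𝒥.curvature_eq_Rm h]
  simp only [← 𝒥.calculus_Psi_apply h]
  rfl

section Tensors

variable (a b c d f : TangentSpace 𝓘(ℝ, E) x)
include h

theorem hermitianCurvature_swap_left :
    𝒥.hermitianCurvature a b c d = -𝒥.hermitianCurvature b a c d := by
  simp only [hermitianCurvature]
  rw [𝒥.curvature_swap_left h, 𝒥.nablaJ_swap h a b, inner_neg_left]
  ring

theorem hermitianCurvature_pair :
    𝒥.hermitianCurvature a b c d = 𝒥.hermitianCurvature c d a b := by
  simp only [hermitianCurvature]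
  rw [𝒥.curvature_pair h, real_inner_comm (𝒥.nablaJ x c d), 𝒥.nablaJ_swap h a c,
    𝒥.nablaJ_swap h b d, 𝒥.nablaJ_swap h b c, 𝒥.nablaJ_swap h a d,
    real_inner_comm (-𝒥.nablaJ x d a)]
  simp only [inner_neg_neg]

theorem hermitianCurvature_swap_right :
    𝒥.hermitianCurvature a b c d = -𝒥.hermitianCurvature a b d c := by
  rw [𝒥.hermitianCurvature_pair h, 𝒥.hermitianCurvature_swap_left h, 𝒥.hermitianCurvature_pair h]

-- The last slot involves no extension of vectors, so linearity is immediate there; the other slots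
-- obtain it through the symmetries.
omit [T2Space M] h in
theorem hermitianCurvature_add_right :
    𝒥.hermitianCurvature a b c (d + f) =
      𝒥.hermitianCurvature a b c d + 𝒥.hermitianCurvature a b c f := by
  simp only [hermitianCurvature, curvature, map_add, inner_add_right]
  ring

omit [T2Space M] h in
theorem hermitianCurvature_smul_right (t : ℝ) :
    𝒥.hermitianCurvature a b c (t • d) = t • 𝒥.hermitianCurvature a b c d := by
  simp only [hermitianCurvature, curvature, map_smul, inner_smul_right, smul_eq_mul]
  ring

theorem hermitianCurvature_add_middle :
    𝒥.hermitianCurvature a b (c + d) f =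
      𝒥.hermitianCurvature a b c f + 𝒥.hermitianCurvature a b d f := by
  simp only [𝒥.hermitianCurvature_swap_right h _ _ _ f, 𝒥.hermitianCurvature_add_right]
  ring

theorem hermitianCurvature_smul_middle (t : ℝ) :
    𝒥.hermitianCurvature a b (t • c) d = t • 𝒥.hermitianCurvature a b c d := by
  simp only [𝒥.hermitianCurvature_swap_right h _ _ _ d, 𝒥.hermitianCurvature_smul_right, smul_neg]

theorem hermitianCurvature_bianchi :
    𝒥.hermitianCurvature a b c d + 𝒥.hermitianCurvature b c a d + 𝒥.hermitianCurvature c a b d =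
      -(inner ℝ (𝒥.nablaJ x a b) (𝒥.nablaJ x c d) + inner ℝ (𝒥.nablaJ x b c) (𝒥.nablaJ x a d)
        + inner ℝ (𝒥.nablaJ x c a) (𝒥.nablaJ x b d)) := by
  have h1 := 𝒥.curvature_bianchi h a b c d
  simp only [hermitianCurvature]
  rw [𝒥.nablaJ_swap h a c, 𝒥.nablaJ_swap h b a, 𝒥.nablaJ_swap h c b]
  simp only [inner_neg_left]
  linarith

theorem hermitianCurvature_nablaJ :
    𝒥.hermitianCurvature a b (𝒥.nablaJ x c d) f =
      𝒥.hermitianCurvature a b c (𝒥.nablaJ x d f) - 𝒥.hermitianCurvature a b d (𝒥.nablaJ x c f) := by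
  obtain ⟨A, rfl⟩ := exists_vectorField_apply_eq a
  obtain ⟨B, rfl⟩ := exists_vectorField_apply_eq b
  obtain ⟨C, rfl⟩ := exists_vectorField_apply_eq c
  obtain ⟨D, rfl⟩ := exists_vectorField_apply_eq d
  obtain ⟨F, rfl⟩ := exists_vectorField_apply_eq f
  simp only [← 𝒥.calculus_Psi_apply h, 𝒥.hermitianCurvature_eq_Qm h]
  exact congrArg (fun f : SF E M => f x) ((𝒥.calculus h).Qm_Psi A B C D F)

theorem hermitianCurvature_J_J :
    𝒥.hermitianCurvature a b (𝒥.J x c) (𝒥.J x d) = 𝒥.hermitianCurvature a b c d := by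
  obtain ⟨A, rfl⟩ := exists_vectorField_apply_eq a
  obtain ⟨B, rfl⟩ := exists_vectorField_apply_eq b
  obtain ⟨C, rfl⟩ := exists_vectorField_apply_eq c
  obtain ⟨D, rfl⟩ := exists_vectorField_apply_eq d
  change 𝒥.hermitianCurvature (A x) (B x) (𝒥.JVF C x) (𝒥.JVF D x) = _
  simp only [𝒥.hermitianCurvature_eq_Qm h]
  exact congrArg (fun f : SF E M => f x) ((𝒥.calculus h).Qm_J_J A B C D)

end Tensors

/-- The curvature form of the canonical Hermitian connection, as a multilinear form. -/
noncomputable def hermitianCurvatureForm (x : M) :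
    TangentSpace 𝓘(ℝ, E) x →ₗ[ℝ] TangentSpace 𝓘(ℝ, E) x →ₗ[ℝ] TangentSpace 𝓘(ℝ, E) x →ₗ[ℝ]
      TangentSpace 𝓘(ℝ, E) x →ₗ[ℝ] ℝ :=
  LinearMap.mk₂ ℝ
    (fun a b => LinearMap.mk₂ ℝ (fun c d => 𝒥.hermitianCurvature a b c d)
      (fun c d f => 𝒥.hermitianCurvature_add_middle h a b c d f)
      (fun t c d => 𝒥.hermitianCurvature_smul_middle h a b c d t)
      (fun c d f => 𝒥.hermitianCurvature_add_right a b c d f)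
      (fun t c d => 𝒥.hermitianCurvature_smul_right a b c d t))
    (fun a b c => by
      ext u v
      simp only [LinearMap.add_apply, LinearMap.mk₂_apply, 𝒥.hermitianCurvature_pair h _ _ u v,
        𝒥.hermitianCurvature_add_middle h])
    (fun t a b => by
      ext u v
      simp only [LinearMap.smul_apply, LinearMap.mk₂_apply, 𝒥.hermitianCurvature_pair h _ _ u v,
        𝒥.hermitianCurvature_smul_middle h])
    (fun a b c => by
      ext u v
      simp only [LinearMap.add_apply, LinearMap.mk₂_apply, 𝒥.hermitianCurvature_pair h _ _ u v,
        𝒥.hermitianCurvature_add_right])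
    (fun t a b => by
      ext u v
      simp only [LinearMap.smul_apply, LinearMap.mk₂_apply, 𝒥.hermitianCurvature_pair h _ _ u v,
        𝒥.hermitianCurvature_smul_right])

/-- The tensors of a nearly Kähler manifold at a point. -/
noncomputable def pointModel (x : M) : PointModel (TangentSpace 𝓘(ℝ, E) x) where
  J := 𝒥.J x
  Psi := 𝒥.nablaJ x
  Q := 𝒥.hermitianCurvatureForm h x
  J_J := 𝒥.sq x
  inner_J_J := 𝒥.inner_map x
  Psi_swap := 𝒥.nablaJ_swap h
  Psi_J := 𝒥.nablaJ_J h
  inner_Psi := 𝒥.inner_nablaJ h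
  Q_swap_left := 𝒥.hermitianCurvature_swap_left h
  Q_swap_right := 𝒥.hermitianCurvature_swap_right h
  Q_pair := 𝒥.hermitianCurvature_pair h
  Q_bianchi := 𝒥.hermitianCurvature_bianchi h
  Q_Psi := 𝒥.hermitianCurvature_nablaJ h
  Q_J_J := 𝒥.hermitianCurvature_J_J h

variable (u v : TangentSpace 𝓘(ℝ, E) x)

omit [T2Space M] in
/-- The tensor `r` in terms of an arbitrary orthonormal basis. -/
theorem inner_r_eq_sum {ι : Type*} [Fintype ι]
    (e : OrthonormalBasis ι ℝ (TangentSpace 𝓘(ℝ, E) x)) :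
    inner ℝ (𝒥.r x u) v = ∑ k, inner ℝ (𝒥.nablaJ x (e k) u) (𝒥.nablaJ x (e k) v) := by
  rw [inner_r]
  exact sum_apply_apply_eq _ e (LinearMap.mk₂ ℝ (fun a b => inner ℝ (𝒥.nablaJ x a u) (𝒥.nablaJ x b v))
    (by simp [inner_add_left]) (by simp [inner_smul_left]) (by simp [inner_add_right])
    (by simp [inner_smul_right]))

include h

/-- In the contraction Ψ(e, e) = 0 removes one correction term; the other two have coefficients -½
and +¼, so Q = R - ¼⟨Ψ_e u, Ψ_e v⟩. -/
theorem ricci_eq_ric_add :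
    ricci 𝓘(ℝ, E) x u v = (𝒥.pointModel h x).ric (stdOrthonormalBasis ℝ (TangentSpace 𝓘(ℝ, E) x)) u v
      + 1 / 4 * inner ℝ (𝒥.r x u) v := by
  rw [inner_r, Finset.mul_sum, PointModel.ric, ← Finset.sum_add_distrib]
  refine Finset.sum_congr rfl fun k _ => ?_
  change _ = 𝒥.hermitianCurvature _ _ _ _ + _
  generalize stdOrthonormalBasis ℝ (TangentSpace 𝓘(ℝ, E) x) k = e
  rw [hermitianCurvature, h x, inner_zero_right, 𝒥.nablaJ_swap h u e, 𝒥.nablaJ_swap h v e,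
    real_inner_comm (-𝒥.nablaJ x e u)]
  simp only [inner_neg_left, inner_neg_right]
  ring

/-- The Bianchi identity splits R(u, Jv, e, Je) into two terms. Moving J across the contraction
shows that they have equal sums, which absorbs the ½ in Ric*. -/
theorem sum_curvature_J :
    ∑ k, curvature 𝓘(ℝ, E) x u (stdOrthonormalBasis ℝ (TangentSpace 𝓘(ℝ, E) x) k) (𝒥.J x v)
      (𝒥.J x (stdOrthonormalBasis ℝ (TangentSpace 𝓘(ℝ, E) x) k)) = 𝒥.starRicci x u v := by
  rw [starRicci]
  set e := stdOrthonormalBasis ℝ (TangentSpace 𝓘(ℝ, E) x)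
  have h1 := sum_apply_adjoint e (LinearMap.mk₂ ℝ
    (fun a b => curvature 𝓘(ℝ, E) x u b (𝒥.J x v) a)
    (fun a b c => by simp only [curvature, inner_add_right]; ring)
    (fun t a b => by simp only [curvature, inner_smul_right, smul_eq_mul]; ring)
    (fun a b c => by
      simp only [𝒥.curvature_pair h u]
      simp only [curvature, inner_add_right]; ring)
    (fun t a b => by
      simp only [𝒥.curvature_pair h u]
      simp only [curvature, inner_smul_right, smul_eq_mul]; ring))
    (𝒥.J x) (fun w => -𝒥.J x w) (fun i j => (𝒥.pointModel h x).inner_J _ _)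
  simp only [LinearMap.mk₂_apply] at h1
  have h2 : ∀ k, curvature 𝓘(ℝ, E) x u (-𝒥.J x (e k)) (𝒥.J x v) (e k) =
      - curvature 𝓘(ℝ, E) x (𝒥.J x v) (e k) u (𝒥.J x (e k)) := fun k => by
    rw [𝒥.curvature_pair h]
    simp only [curvature, inner_neg_right]
  have h3 : ∀ k, curvature 𝓘(ℝ, E) x u (𝒥.J x v) (e k) (𝒥.J x (e k)) =
      curvature 𝓘(ℝ, E) x u (e k) (𝒥.J x v) (𝒥.J x (e k))
        - curvature 𝓘(ℝ, E) x (𝒥.J x v) (e k) u (𝒥.J x (e k)) := fun k => by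
    have := 𝒥.curvature_bianchi h u (𝒥.J x v) (e k) (𝒥.J x (e k))
    rw [𝒥.curvature_swap_left h (e k) u] at this
    linarith
  simp only [h3, Finset.sum_sub_distrib]
  simp only [h2, Finset.sum_neg_distrib] at h1
  linarith

theorem inner_r_eq_ricci_sub_starRicci :
    inner ℝ (𝒥.r x u) v = ricci 𝓘(ℝ, E) x u v - 𝒥.starRicci x u v := by
  rw [← 𝒥.sum_curvature_J h, ricci, ← Finset.sum_sub_distrib, inner_r]
  refine Finset.sum_congr rfl fun k _ => ?_
  rw [𝒥.curvature_sub_curvature_J h, 𝒥.nablaJ_swap h u, 𝒥.nablaJ_swap h v, inner_neg_neg]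

end AlmostHermitian
end NearlyKahler

/-! ### Ricci curvature on the eigenspaces of r -/

namespace NearlyKahler

namespace AlmostHermitian

variable {E : Type*} [NormedAddCommGroup E] [NormedSpace ℝ E] [FiniteDimensional ℝ E]
  {M : Type*} [TopologicalSpace M] [ChartedSpace E M] [IsManifold 𝓘(ℝ, E) ∞ M]
  [RiemannianBundle (fun x : M => TangentSpace 𝓘(ℝ, E) x)]
  [IsContMDiffRiemannianBundle 𝓘(ℝ, E) ∞ E (fun x : M => TangentSpace 𝓘(ℝ, E) x)]
  (𝒥 : AlmostHermitian 𝓘(ℝ, E) M)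

theorem isSymmetric_r (x : M) :
    (𝒥.r x : TangentSpace 𝓘(ℝ, E) x →ₗ[ℝ] TangentSpace 𝓘(ℝ, E) x).IsSymmetric := fun u v => by
  simp only [ContinuousLinearMap.coe_coe]
  rw [real_inner_comm (𝒥.r x v), inner_r, inner_r]
  exact Finset.sum_congr rfl fun k _ => real_inner_comm _ _

variable {𝒥} {x : M} {c d : ℝ} {u v : TangentSpace 𝓘(ℝ, E) x}

theorem mem_eigenspace_iff : u ∈ 𝒥.eigenspace x c ↔ 𝒥.r x u = c • u :=
  Module.End.mem_eigenspace_iff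

theorem orthogonalFamily_eigenspace (x : M) {ι : Type*} {lam : ι → ℝ}
    (hlam : Function.Injective lam) :
    OrthogonalFamily ℝ (fun i => 𝒥.eigenspace x (lam i))
      fun i => (𝒥.eigenspace x (lam i)).subtypeₗᵢ :=
  (𝒥.isSymmetric_r x).orthogonalFamily_eigenspaces.comp hlam

theorem ricci_eq_zero [T2Space M] (h : 𝒥.IsNearlyKahler) (hcd : c ≠ d)
    (hu : u ∈ 𝒥.eigenspace x c) (hv : v ∈ 𝒥.eigenspace x d) : ricci 𝓘(ℝ, E) x u v = 0 := by
  have h0 : inner ℝ u v = 0 :=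
    (𝒥.isSymmetric_r x).orthogonalFamily_eigenspaces hcd ⟨u, hu⟩ ⟨v, hv⟩
  rw [mem_eigenspace_iff] at hu hv
  rw [𝒥.ricci_eq_ric_add h, (𝒥.pointModel h x).ric_eq_zero _ (𝒥.inner_r x) hcd hu hv, hu,
    real_inner_smul_left, h0]
  ring

theorem inner_rPart_eq_sum [T2Space M] (h : 𝒥.IsNearlyKahler) (W : Submodule ℝ (TangentSpace 𝓘(ℝ, E) x)) :
    inner ℝ (𝒥.rPart x W u) v = ∑ k, inner ℝ
      (𝒥.nablaJ x u (stdOrthonormalBasis ℝ W k : TangentSpace 𝓘(ℝ, E) x))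
      (𝒥.nablaJ x v (stdOrthonormalBasis ℝ W k : TangentSpace 𝓘(ℝ, E) x)) := by
  rw [inner_rPart, traceOn, ← Finset.sum_neg_distrib]
  refine Finset.sum_congr rfl fun k _ => ?_
  rw [ContinuousLinearMap.comp_apply, 𝒥.inner_nablaJ h, neg_neg, real_inner_comm]

/-- The sum is basis-independent; in an orthonormal basis collected from the eigenspaces, r is the
scalar `lam s` on each block. -/
theorem sum_inner_nablaJ_r [T2Space M] (h : 𝒥.IsNearlyKahler) {p : ℕ} {lam : Fin p → ℝ}
    (hlam : Function.Injective lam)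
    (hint : DirectSum.IsInternal (fun i => 𝒥.eigenspace x (lam i)))
    {ι : Type*} [Fintype ι] (e : OrthonormalBasis ι ℝ (TangentSpace 𝓘(ℝ, E) x)) :
    ∑ i, inner ℝ (𝒥.nablaJ x u (e i)) (𝒥.nablaJ x v (𝒥.r x (e i))) =
      ∑ s, lam s * inner ℝ (𝒥.rPart x (𝒥.eigenspace x (lam s)) u) v := by
  let f := hint.collectedOrthonormalBasis (orthogonalFamily_eigenspace x hlam)
    fun s => stdOrthonormalBasis ℝ (𝒥.eigenspace x (lam s))
  have hf : ∀ s k, f ⟨s, k⟩ = (stdOrthonormalBasis ℝ (𝒥.eigenspace x (lam s)) k : TangentSpace 𝓘(ℝ, E) x) := fun s k => by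
    simp [f, DirectSum.IsInternal.collectedOrthonormalBasis]
  have h1 := sum_apply_apply_eq e f ((innerₗ (TangentSpace 𝓘(ℝ, E) x)).compl₁₂
    (𝒥.nablaJ x u).toLinearMap ((𝒥.nablaJ x v).toLinearMap ∘ₗ (𝒥.r x).toLinearMap))
  simp only [LinearMap.compl₁₂_apply, LinearMap.comp_apply, ContinuousLinearMap.coe_coe,
    innerₗ_apply_apply] at h1
  rw [h1, Fintype.sum_sigma]
  refine Finset.sum_congr rfl fun s _ => ?_
  rw [inner_rPart_eq_sum h, Finset.mul_sum]
  refine Finset.sum_congr rfl fun k _ => ?_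
  rw [hf, mem_eigenspace_iff.mp (stdOrthonormalBasis ℝ (𝒥.eigenspace x (lam s)) k).2, map_smul,
    inner_smul_right]

theorem ricci_eq_of_mem_eigenspace [T2Space M] (h : 𝒥.IsNearlyKahler) {p : ℕ} {lam : Fin p → ℝ}
    (hlam : Function.Injective lam)
    (hint : DirectSum.IsInternal (fun i => 𝒥.eigenspace x (lam i))) (hc : c ≠ 0)
    (hu : u ∈ 𝒥.eigenspace x c) (hv : v ∈ 𝒥.eigenspace x c) :
    ricci 𝓘(ℝ, E) x u v = c / 4 * inner ℝ u v +
      1 / c * ∑ s, lam s * inner ℝ (𝒥.rPart x (𝒥.eigenspace x (lam s)) u) v := by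
  rw [mem_eigenspace_iff] at hu hv
  rw [𝒥.ricci_eq_ric_add h, (𝒥.pointModel h x).ric_of_eigenvector _ (𝒥.inner_r x) hc hv, hu,
    real_inner_smul_left, ← sum_inner_nablaJ_r h hlam hint (stdOrthonormalBasis ℝ _)]
  change 1 / c * ∑ i, inner ℝ (𝒥.nablaJ x u _) (𝒥.nablaJ x v (𝒥.r x _)) + _ = _
  ring

/-- For an eigenvector u, c‖u‖² = ∑ ‖Ψ_{e_k} u‖² = ∑ ‖Ψ_u e_k‖², and strictness prevents all these
terms from vanishing. -/
theorem pos_of_eigenspace_ne_bot (h : 𝒥.IsNearlyKahler) (hs : 𝒥.IsStrict)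
    (hc : 𝒥.eigenspace x c ≠ ⊥) : 0 < c := by
  obtain ⟨u, hu, hu0⟩ := Submodule.exists_mem_ne_zero_of_ne_bot hc
  rw [mem_eigenspace_iff] at hu
  have h1 := 𝒥.inner_r x u u
  rw [hu, real_inner_smul_left] at h1
  have h2 : 0 < ∑ k, inner ℝ (𝒥.nablaJ x (stdOrthonormalBasis ℝ (TangentSpace 𝓘(ℝ, E) x) k) u)
      (𝒥.nablaJ x (stdOrthonormalBasis ℝ (TangentSpace 𝓘(ℝ, E) x) k) u) := by
    refine (Finset.sum_nonneg fun k _ => real_inner_self_nonneg).lt_of_ne fun h0 => hs x u hu0 ?_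
    rw [eq_comm, Finset.sum_eq_zero_iff_of_nonneg fun k _ => real_inner_self_nonneg] at h0
    apply ContinuousLinearMap.coe_injective
    refine (stdOrthonormalBasis ℝ (TangentSpace 𝓘(ℝ, E) x)).toBasis.ext fun k => ?_
    have := h0 k (Finset.mem_univ k)
    rw [inner_self_eq_zero] at this
    simp [𝒥.nablaJ_swap h u, this]
  rw [← h1] at h2
  exact pos_of_mul_pos_left h2 real_inner_self_nonneg

end AlmostHermitian
end NearlyKahler

/-! ### Parallelism of r and constancy of its traces -/

namespace NearlyKahler

open Filter Topology

section LocallyConstant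

variable {E : Type*} [NormedAddCommGroup E] [NormedSpace ℝ E]
  {M : Type*} [TopologicalSpace M] [ChartedSpace E M] [IsManifold 𝓘(ℝ, E) ∞ M]

/-- A function with zero derivative is locally constant. -/
theorem isLocallyConstant_of_mvfderiv_eq_zero {f : M → ℝ} (hf : MDiff f)
    (h0 : ∀ x : M, d% f x = 0) : IsLocallyConstant f := by
  have : IsManifold 𝓘(ℝ, E) 1 M := IsManifold.of_le (n := ∞) (by simp)
  rw [IsLocallyConstant.iff_eventually_eq]
  intro x
  let φ := chartAt E x
  have hx : x ∈ φ.source := mem_chart_source E x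
  have hd : ∀ z ∈ φ.target, HasFDerivAt (f ∘ φ.symm) (0 : E →L[ℝ] ℝ) z := fun z hz => by
    have h1 : MDiffAt φ.symm z := mdifferentiableAt_atlas_symm (chart_mem_atlas E x) hz
    have h2 : HasMFDerivAt 𝓘(ℝ, E) 𝓘(ℝ, ℝ) (f ∘ φ.symm) z _ :=
      (hf (φ.symm z)).hasMFDerivAt.comp z h1.hasMFDerivAt
    have h3 : mfderiv 𝓘(ℝ, E) 𝓘(ℝ, ℝ) f (φ.symm z) = 0 := by
      ext v
      exact congr($(h0 (φ.symm z)) v)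
    rw [h3, ContinuousLinearMap.zero_comp] at h2
    exact h2.hasFDerivAt
  obtain ⟨ε, hε, hball⟩ := Metric.isOpen_iff.mp φ.open_target _ (φ.map_source hx)
  have hV : φ.source ∩ φ ⁻¹' Metric.ball (φ x) ε ∈ 𝓝 x :=
    inter_mem (φ.open_source.mem_nhds hx)
      (φ.continuousAt hx (Metric.ball_mem_nhds _ hε))
  filter_upwards [hV] with y hy
  have := (convex_ball (φ x) ε).is_const_of_fderivWithin_eq_zero (𝕜 := ℝ) (f := f ∘ φ.symm)
    (fun z hz => (hd z (hball hz)).differentiableAt.differentiableWithinAt)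
    (fun z hz => (hd z (hball hz)).hasFDerivWithinAt.fderivWithin
      (Metric.isOpen_ball.uniqueDiffWithinAt hz)) hy.2 (Metric.mem_ball_self hε)
  simpa [φ.left_inv hy.1, φ.left_inv hx] using this

end LocallyConstant

variable {E : Type*} [NormedAddCommGroup E] [NormedSpace ℝ E] [FiniteDimensional ℝ E]
  {M : Type*} [TopologicalSpace M] [T2Space M] [ChartedSpace E M] [IsManifold 𝓘(ℝ, E) ∞ M]
  [RiemannianBundle (fun x : M => TangentSpace 𝓘(ℝ, E) x)]
  [IsContMDiffRiemannianBundle 𝓘(ℝ, E) ∞ E (fun x : M => TangentSpace 𝓘(ℝ, E) x)]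

omit [FiniteDimensional ℝ E] [T2Space M] [IsManifold 𝓘(ℝ, E) ∞ M]
  [RiemannianBundle (fun x : M => TangentSpace 𝓘(ℝ, E) x)]
  [IsContMDiffRiemannianBundle 𝓘(ℝ, E) ∞ E (fun x : M => TangentSpace 𝓘(ℝ, E) x)] in
theorem SF.sum_apply {ι : Type*} (s : Finset ι) (f : ι → SF E M) (x : M) :
    (∑ i ∈ s, f i) x = ∑ i ∈ s, f i x := by
  classical
  induction s using Finset.induction_on with
  | empty => rfl
  | insert a s ha ih => rw [Finset.sum_insert ha, Finset.sum_insert ha, ← ih]; rfl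

omit [FiniteDimensional ℝ E] [T2Space M]
  [RiemannianBundle (fun x : M => TangentSpace 𝓘(ℝ, E) x)]
  [IsContMDiffRiemannianBundle 𝓘(ℝ, E) ∞ E (fun x : M => TangentSpace 𝓘(ℝ, E) x)] in
theorem VF.deriv_congr {f g : SF E M} {x : M} (h : ⇑f =ᶠ[𝓝 x] g) (X : VF E M) :
    VF.deriv X f x = VF.deriv X g x := by
  change d% (f : M → ℝ) x (X x) = d% (g : M → ℝ) x (X x)
  have := h.mfderiv_eq (I := 𝓘(ℝ, E)) (I' := 𝓘(ℝ, ℝ))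
  exact congr($this (X x))

namespace AlmostHermitian

variable (𝒥 : AlmostHermitian 𝓘(ℝ, E) M) (h : 𝒥.IsNearlyKahler)

section Frame

variable {e : Fin (Module.finrank ℝ E) → VF E M} {x : M}
  (he : ∀ᶠ y in 𝓝 x, Orthonormal ℝ (fun i => e i y))
include he

/-- The connection form of the canonical connection in an orthonormal frame is skew. -/
theorem sum_nb_frame (F : TangentSpace 𝓘(ℝ, E) x →ₗ[ℝ] TangentSpace 𝓘(ℝ, E) x →ₗ[ℝ] ℝ)
    (W : VF E M) :
    ∑ i, (F ((𝒥.calculus h).nb W (e i) x) (e i x) + F (e i x) ((𝒥.calculus h).nb W (e i) x)) = 0 := by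
  have hskew : ∀ i j, inner ℝ ((𝒥.calculus h).nb W (e i) x) (e j x) =
      -inner ℝ (e i x) ((𝒥.calculus h).nb W (e j) x) := fun i j => by
    have h1 := congrArg (fun f : SF E M => f x) ((𝒥.calculus h).D_g_nb W (e i) (e j))
    have h2 : VF.deriv W (VF.metric (e i) (e j)) x =
        VF.deriv W (ContMDiffMap.const (if i = j then 1 else 0)) x := by
      refine VF.deriv_congr ?_ W
      filter_upwards [he] with y hy
      exact orthonormal_iff_ite.mp hy i j
    have h3 : VF.deriv W (ContMDiffMap.const (if i = j then (1 : ℝ) else 0) : SF E M) x = 0 := by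
      change d% (fun _ : M => (if i = j then (1 : ℝ) else 0)) x (W x) = 0
      rw [mvfderiv_const]; rfl
    have h4 : VF.deriv W (VF.metric (e i) (e j)) x =
        inner ℝ ((𝒥.calculus h).nb W (e i) x) (e j x) +
          inner ℝ (e i x) ((𝒥.calculus h).nb W (e j) x) := h1
    linarith
  let b := frameBasis he.self_of_nhds
  have hb : ∀ i, b i = e i x := fun i => frameBasis_apply _ i
  -- Differentiating the locally constant ⟨e_i, e_j⟩ made `hskew`, so e_i ↦ ∇̄_W e_i extends to an
  -- endomorphism with adjoint -T, and the two halves of the sum cancel.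
  let T : TangentSpace 𝓘(ℝ, E) x →ₗ[ℝ] TangentSpace 𝓘(ℝ, E) x :=
    b.toBasis.constr ℝ fun i => (𝒥.calculus h).nb W (e i) x
  have hT : ∀ i, T (e i x) = (𝒥.calculus h).nb W (e i) x := fun i => by
    rw [← hb, ← b.coe_toBasis, Module.Basis.constr_basis]
  have := sum_apply_adjoint b F T (fun v => -T v) fun i j => by
    simp only [hb, hT, inner_neg_right]; exact hskew i j
  simp only [hb, hT, map_neg, Finset.sum_neg_distrib] at this
  rw [Finset.sum_add_distrib, this, neg_add_cancel]

end Frame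

theorem inner_r_frame {e : Fin (Module.finrank ℝ E) → VF E M} {y : M}
    (he : Orthonormal ℝ (fun i => e i y)) (X Z : VF E M) :
    inner ℝ (𝒥.r y (X y)) (Z y) =
      (∑ k, VF.metric ((𝒥.calculus h).Psi (e k) X) ((𝒥.calculus h).Psi (e k) Z) : SF E M) y := by
  rw [𝒥.inner_r_eq_sum _ _ (frameBasis he)]
  simp only [frameBasis_apply, SF.sum_apply]
  refine Finset.sum_congr rfl fun k _ => ?_
  rw [VF.metric_apply, 𝒥.calculus_Psi_apply, 𝒥.calculus_Psi_apply]

include h in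
theorem contMDiff_r_apply (X : VF E M) : CMDiff ∞ (T% (fun y => 𝒥.r y (X y))) := by
  refine contMDiff_of_inner fun Z x => ?_
  obtain ⟨e, he⟩ := exists_orthonormal_vectorFields (E := E) x
  refine ((∑ k, VF.metric ((𝒥.calculus h).Psi (e k) X) ((𝒥.calculus h).Psi (e k) Z) : SF E M).contMDiff
    x).congr_of_eventuallyEq ?_
  filter_upwards [he] with y hy
  exact 𝒥.inner_r_frame h hy X Z

/-- The tensor `r` on smooth vector fields. -/
noncomputable def rVF : Module.End ℝ (VF E M) where
  toFun X := ⟨fun y => 𝒥.r y (X y), 𝒥.contMDiff_r_apply h X⟩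
  map_add' X Y := by ext y : 1; exact map_add (𝒥.r y) (X y) (Y y)
  map_smul' c X := by ext y : 1; exact map_smul (𝒥.r y) c (X y)

/-- The tensor `r` is parallel for the canonical connection. -/
theorem nb_rVF (W X : VF E M) :
    (𝒥.calculus h).nb W (𝒥.rVF h X) = 𝒥.rVF h ((𝒥.calculus h).nb W X) := by
  set K := 𝒥.calculus h
  refine K.ext_g _ _ fun Z => ?_
  ext x
  obtain ⟨e, he⟩ := exists_orthonormal_vectorFields (E := E) x
  have h1 : K.D W (K.g (𝒥.rVF h X) Z) x = K.D W (∑ k, K.g (K.Psi (e k) X) (K.Psi (e k) Z)) x := by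
    refine VF.deriv_congr ?_ W
    filter_upwards [he] with y hy
    exact 𝒥.inner_r_frame h hy X Z
  have hsum : ∀ X Z : VF E M, K.g (𝒥.rVF h X) Z x = ∑ k, K.g (K.Psi (e k) X) (K.Psi (e k) Z) x :=
    fun X Z => by
      have := 𝒥.inner_r_frame h he.self_of_nhds X Z
      rw [SF.sum_apply] at this
      exact this
  -- The frame need not be parallel; the terms that differentiate it cancel by skewness of the
  -- connection form.
  have h2 : ∑ k, (K.g (K.Psi (K.nb W (e k)) X) (K.Psi (e k) Z) x
      + K.g (K.Psi (e k) X) (K.Psi (K.nb W (e k)) Z) x) = 0 := by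
    have := 𝒥.sum_nb_frame h he (LinearMap.mk₂ ℝ
      (fun a b => inner ℝ (𝒥.nablaJ x a (X x)) (𝒥.nablaJ x b (Z x)))
      (by simp [inner_add_left]) (by simp [inner_smul_left]) (by simp [inner_add_right])
      (by simp [inner_smul_right])) W
    simp only [LinearMap.mk₂_apply, ← 𝒥.calculus_Psi_apply h] at this
    exact this
  rw [K.D_g_nb, map_sum, ContMDiffMap.coe_add, Pi.add_apply, SF.sum_apply] at h1
  simp only [K.D_g_nb, K.nb_Psi, map_add, LinearMap.add_apply, ContMDiffMap.coe_add, Pi.add_apply,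
    Finset.sum_add_distrib] at h1 h2
  rw [hsum X (K.nb W Z)] at h1
  rw [hsum (K.nb W X)]
  linarith

theorem nb_aeval_rVF (q : Polynomial ℝ) (W X : VF E M) :
    (𝒥.calculus h).nb W (Polynomial.aeval (𝒥.rVF h) q X) =
      Polynomial.aeval (𝒥.rVF h) q ((𝒥.calculus h).nb W X) := by
  have hc : Commute ((𝒥.calculus h).nb W : Module.End ℝ (VF E M)) (𝒥.rVF h) :=
    LinearMap.ext fun X => 𝒥.nb_rVF h W X
  have hq : Commute ((𝒥.calculus h).nb W : Module.End ℝ (VF E M))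
      (Polynomial.aeval (𝒥.rVF h) q) := by
    induction q using Polynomial.induction_on' with
    | add p q hp hq => rw [map_add]; exact hp.add_right hq
    | monomial n a =>
      rw [Polynomial.aeval_monomial]
      exact (Algebra.commute_algebraMap_right a _).mul_right (hc.pow_right n)
  exact congr($hq X)

theorem aeval_rVF_apply (q : Polynomial ℝ) (X : VF E M) (x : M) :
    Polynomial.aeval (𝒥.rVF h) q X x =
      Polynomial.aeval (𝒥.r x : Module.End ℝ (TangentSpace 𝓘(ℝ, E) x)) q (X x) := by
  induction q using Polynomial.induction_on' generalizing X with
  | add p q hp hq => simp only [map_add, LinearMap.add_apply, ← hp, ← hq]; rfl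
  | monomial n a =>
    have hn : ((𝒥.rVF h ^ n) X) x =
        ((𝒥.r x : Module.End ℝ (TangentSpace 𝓘(ℝ, E) x)) ^ n) (X x) := by
      induction n with
      | zero => rfl
      | succ n ih =>
        rw [pow_succ', pow_succ', Module.End.mul_apply, Module.End.mul_apply, ← ih]
        rfl
    rw [Polynomial.aeval_monomial, Polynomial.aeval_monomial, Module.End.mul_apply,
      Module.End.mul_apply, ← hn]
    rfl

/-- The trace of a polynomial in `r`. -/
noncomputable def traceAeval (q : Polynomial ℝ) (x : M) : ℝ :=
  LinearMap.trace ℝ _ (Polynomial.aeval (𝒥.r x : Module.End ℝ (TangentSpace 𝓘(ℝ, E) x)) q)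

theorem traceAeval_frame {e : Fin (Module.finrank ℝ E) → VF E M} {y : M}
    (he : Orthonormal ℝ (fun i => e i y)) (q : Polynomial ℝ) :
    𝒥.traceAeval q y = (∑ k, VF.metric (Polynomial.aeval (𝒥.rVF h) q (e k)) (e k) : SF E M) y := by
  rw [traceAeval, LinearMap.trace_eq_sum_inner _ (frameBasis he), SF.sum_apply]
  refine Finset.sum_congr rfl fun k _ => ?_
  rw [VF.metric_apply, 𝒥.aeval_rVF_apply, frameBasis_apply, real_inner_comm]

-- Since q(r) is ∇̄-parallel, the derivative of ∑ ⟨q(r) e_k, e_k⟩ only involves derivatives of the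
-- frame, which cancel by `sum_nb_frame`.
include h in
theorem isLocallyConstant_traceAeval (q : Polynomial ℝ) :
    IsLocallyConstant (𝒥.traceAeval q : M → ℝ) := by
  have hloc : ∀ x : M, ∃ e : Fin (Module.finrank ℝ E) → VF E M,
      (∀ᶠ y in 𝓝 x, Orthonormal ℝ (fun i => e i y)) ∧ 𝒥.traceAeval q =ᶠ[𝓝 x]
        (∑ k, VF.metric (Polynomial.aeval (𝒥.rVF h) q (e k)) (e k) : SF E M) := fun x => by
    obtain ⟨e, he⟩ := exists_orthonormal_vectorFields (E := E) x
    refine ⟨e, he, ?_⟩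
    filter_upwards [he] with y hy
    exact 𝒥.traceAeval_frame h hy q
  refine isLocallyConstant_of_mvfderiv_eq_zero (E := E) (fun x => ?_) fun x => ?_
  · obtain ⟨e, -, heq⟩ := hloc x
    exact (SF.mdiffAt _ x).congr_of_eventuallyEq heq
  · obtain ⟨e, he, heq⟩ := hloc x
    ext w
    obtain ⟨W, rfl⟩ := exists_vectorField_apply_eq w
    have h1 := congr($(heq.mfderiv_eq (I := 𝓘(ℝ, E)) (I' := 𝓘(ℝ, ℝ))) (W x))
    refine h1.trans ?_
    change VF.deriv W (∑ k, VF.metric (Polynomial.aeval (𝒥.rVF h) q (e k)) (e k)) x = 0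
    set K := 𝒥.calculus h
    have h2 := 𝒥.sum_nb_frame h he ((innerₗ (TangentSpace 𝓘(ℝ, E) x)).compl₁₂
      (Polynomial.aeval (𝒥.r x : Module.End ℝ (TangentSpace 𝓘(ℝ, E) x)) q) LinearMap.id) W
    simp only [LinearMap.compl₁₂_apply, LinearMap.id_apply, innerₗ_apply_apply,
      ← 𝒥.aeval_rVF_apply h, ← 𝒥.nb_aeval_rVF h] at h2
    rw [map_sum, SF.sum_apply, ← h2]
    refine Finset.sum_congr rfl fun k _ => ?_
    exact congrArg (fun f : SF E M => f x) (K.D_g_nb W _ _)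

end AlmostHermitian
end NearlyKahler

/-! ### Constancy of the spectrum and conclusion -/

namespace NearlyKahler

theorem trace_aeval_eq_sum_eigenvalues {V : Type*} [NormedAddCommGroup V] [InnerProductSpace ℝ V]
    [FiniteDimensional ℝ V] {A : Module.End ℝ V} (hA : LinearMap.IsSymmetric A)
    (q : Polynomial ℝ) :
    LinearMap.trace ℝ V (Polynomial.aeval A q) = ∑ i, q.eval (hA.eigenvalues rfl i) := by
  rw [LinearMap.trace_eq_sum_inner _ (hA.eigenvectorBasis rfl)]
  refine Finset.sum_congr rfl fun i _ => ?_
  rw [Module.End.aeval_apply_of_hasEigenvector (hA.hasEigenvector_eigenvectorBasis rfl i),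
    inner_smul_right, real_inner_self_eq_norm_sq, OrthonormalBasis.norm_eq_one]
  simp

/-- If the traces of all polynomials in two symmetric operators agree, so do their eigenvalues. -/
theorem hasEigenvalue_of_trace_aeval_eq {V V' : Type*} [NormedAddCommGroup V]
    [InnerProductSpace ℝ V] [FiniteDimensional ℝ V] [NormedAddCommGroup V']
    [InnerProductSpace ℝ V'] [FiniteDimensional ℝ V'] {S : Module.End ℝ V} {T : Module.End ℝ V'}
    (hS : LinearMap.IsSymmetric S) (hT : LinearMap.IsSymmetric T)
    (h : ∀ q : Polynomial ℝ, LinearMap.trace ℝ V (Polynomial.aeval S q) =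
      LinearMap.trace ℝ V' (Polynomial.aeval T q)) {c : ℝ} (hc : T.HasEigenvalue c) :
    S.HasEigenvalue c := by
  -- This polynomial vanishes exactly on the spectrum of `S`. The trace of its square is zero for
  -- `S`, hence for `T`, where it is a sum of squares over the eigenvalues; so each of these is a
  -- root of q.
  let q : Polynomial ℝ := ∏ i, (Polynomial.X - Polynomial.C (hS.eigenvalues rfl i))
  have hq : ∀ t : ℝ, q.eval t = ∏ i, (t - hS.eigenvalues rfl i) := fun t => by
    simp [q, Polynomial.eval_prod]
  have h1 : LinearMap.trace ℝ V (Polynomial.aeval S (q ^ 2)) = 0 := by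
    rw [trace_aeval_eq_sum_eigenvalues hS]
    refine Finset.sum_eq_zero fun i _ => ?_
    rw [Polynomial.eval_pow, hq, Finset.prod_eq_zero (Finset.mem_univ i) (sub_self _)]
    simp
  rw [h, trace_aeval_eq_sum_eigenvalues hT, Finset.sum_eq_zero_iff_of_nonneg fun i _ => by
    rw [Polynomial.eval_pow]; positivity] at h1
  obtain ⟨j, rfl⟩ := hT.exists_eigenvalues_eq rfl hc
  have h2 := h1 j (Finset.mem_univ j)
  rw [Polynomial.eval_pow, sq_eq_zero_iff, hq, Finset.prod_eq_zero_iff] at h2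
  obtain ⟨i, -, hi⟩ := h2
  rw [RCLike.ofReal_real_eq_id, id, sub_eq_zero.mp hi]
  exact hS.hasEigenvalue_eigenvalues rfl i

namespace AlmostHermitian

variable {E : Type*} [NormedAddCommGroup E] [NormedSpace ℝ E] [FiniteDimensional ℝ E]
  {M : Type*} [TopologicalSpace M] [T2Space M] [ChartedSpace E M] [IsManifold 𝓘(ℝ, E) ∞ M]
  [RiemannianBundle (fun x : M => TangentSpace 𝓘(ℝ, E) x)]
  [IsContMDiffRiemannianBundle 𝓘(ℝ, E) ∞ E (fun x : M => TangentSpace 𝓘(ℝ, E) x)]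
  {𝒥 : AlmostHermitian 𝓘(ℝ, E) M}

/-- The eigenvalues of `r` do not depend on the point. -/
theorem eigenspace_ne_bot_of_eigenspace_ne_bot [PreconnectedSpace M] (h : 𝒥.IsNearlyKahler)
    (x y : M) {c : ℝ} (hc : 𝒥.eigenspace y c ≠ ⊥) : 𝒥.eigenspace x c ≠ ⊥ :=
  hasEigenvalue_of_trace_aeval_eq (𝒥.isSymmetric_r x) (𝒥.isSymmetric_r y)
    (fun q => (𝒥.isLocallyConstant_traceAeval h q).apply_eq_of_preconnectedSpace x y) hc

omit [T2Space M] in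
theorem isInternal_eigenspace {x : M} {ι : Type*} [DecidableEq ι] {lam : ι → ℝ}
    (hlam : Function.Injective lam) (h : ∀ c, 𝒥.eigenspace x c ≠ ⊥ → ∃ i, lam i = c) :
    DirectSum.IsInternal (fun i => 𝒥.eigenspace x (lam i)) := by
  rw [(orthogonalFamily_eigenspace x hlam).isInternal_iff, eq_bot_iff,
    ← (𝒥.isSymmetric_r x).orthogonalComplement_iSup_eigenspaces_eq_bot]
  refine Submodule.orthogonal_le (iSup_le fun c => ?_)
  by_cases hc : 𝒥.eigenspace x c = ⊥
  · exact hc.le.trans bot_le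
  · obtain ⟨i, rfl⟩ := h c hc
    exact le_iSup (fun i => 𝒥.eigenspace x (lam i)) i

variable (𝒥) in
omit [T2Space M] in
theorem exists_eigenvalues (x : M) : ∃ (p : ℕ) (lam : Fin p → ℝ), Function.Injective lam ∧
    ∀ c, 𝒥.eigenspace x c ≠ ⊥ ↔ ∃ i, lam i = c := by
  have hfin : {c : ℝ | 𝒥.eigenspace x c ≠ ⊥}.Finite :=
    Module.End.finite_hasEigenvalue (𝒥.r x : Module.End ℝ (TangentSpace 𝓘(ℝ, E) x))
  let e := hfin.toFinset.equivFin.symm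
  refine ⟨_, fun i => e i, Subtype.val_injective.comp e.injective, fun c => ⟨fun hc => ?_, ?_⟩⟩
  · exact ⟨e.symm ⟨c, hfin.mem_toFinset.mpr hc⟩, by simp⟩
  · rintro ⟨i, rfl⟩
    exact hfin.mem_toFinset.mp (e i).2

end AlmostHermitian
end NearlyKahler

theorem lemma2p1 {E : Type*} [NormedAddCommGroup E] [NormedSpace ℝ E] [FiniteDimensional ℝ E]
    {M : Type*} [TopologicalSpace M] [T2Space M] [SecondCountableTopology M] [ConnectedSpace M]
    [ChartedSpace E M] [IsManifold 𝓘(ℝ, E) ∞ M]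
    [RiemannianBundle (fun x : M => TangentSpace 𝓘(ℝ, E) x)]
    [IsContMDiffRiemannianBundle 𝓘(ℝ, E) ∞ E (fun x : M => TangentSpace 𝓘(ℝ, E) x)]
    (𝒥 : NearlyKahler.AlmostHermitian 𝓘(ℝ, E) M)
    (hNK : 𝒥.IsNearlyKahler) (hstrict : 𝒥.IsStrict) :
    (∀ (x : M) (u v : TangentSpace 𝓘(ℝ, E) x),
      inner ℝ (𝒥.r x u) v = NearlyKahler.ricci 𝓘(ℝ, E) x u v - 𝒥.starRicci x u v) ∧
    ∃ (p : ℕ) (lam : Fin p → ℝ),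
      Function.Injective lam ∧ (∀ i, 0 < lam i) ∧
      (∀ (x : M) (i : Fin p), 𝒥.eigenspace x (lam i) ≠ ⊥) ∧
      (∀ x : M, DirectSum.IsInternal (fun i => 𝒥.eigenspace x (lam i))) ∧
      (∀ (x : M) (i j : Fin p), i ≠ j →
        ∀ u ∈ 𝒥.eigenspace x (lam i), ∀ v ∈ 𝒥.eigenspace x (lam j),
          NearlyKahler.ricci 𝓘(ℝ, E) x u v = 0) ∧
      (∀ (x : M) (i : Fin p),
        ∀ u ∈ 𝒥.eigenspace x (lam i), ∀ v ∈ 𝒥.eigenspace x (lam i),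
          NearlyKahler.ricci 𝓘(ℝ, E) x u v =
            lam i / 4 * inner ℝ u v +
              1 / lam i *
                ∑ s, lam s * inner ℝ (𝒥.rPart x (𝒥.eigenspace x (lam s)) u) v) := by
  refine ⟨fun x u v => 𝒥.inner_r_eq_ricci_sub_starRicci hNK u v, ?_⟩
  obtain ⟨x₀⟩ := (inferInstance : Nonempty M)
  -- The eigenvalues are listed at one point. Transport from x₀ to x shows that each occurs at x;
  -- transport back shows that x has no others.
  obtain ⟨p, lam, hlam, hmem⟩ := 𝒥.exists_eigenvalues x₀
  have hne : ∀ (x : M) (i : Fin p), 𝒥.eigenspace x (lam i) ≠ ⊥ := fun x i =>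
    NearlyKahler.AlmostHermitian.eigenspace_ne_bot_of_eigenspace_ne_bot hNK x x₀
      ((hmem _).mpr ⟨i, rfl⟩)
  have hpos : ∀ i, 0 < lam i := fun i =>
    NearlyKahler.AlmostHermitian.pos_of_eigenspace_ne_bot hNK hstrict (hne x₀ i)
  have hint : ∀ x : M, DirectSum.IsInternal (fun i => 𝒥.eigenspace x (lam i)) := fun x =>
    NearlyKahler.AlmostHermitian.isInternal_eigenspace hlam fun c hc => (hmem c).mp
      (NearlyKahler.AlmostHermitian.eigenspace_ne_bot_of_eigenspace_ne_bot hNK x₀ x hc)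
  exact ⟨p, lam, hlam, hpos, hne, hint,
    fun x i j hij u hu v hv =>
      NearlyKahler.AlmostHermitian.ricci_eq_zero hNK (hlam.ne hij) hu hv,
    fun x i u hu v hv => NearlyKahler.AlmostHermitian.ricci_eq_of_mem_eigenspace hNK hlam (hint x)
      (hpos i).ne' hu hv⟩
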